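/- Let $(S,g)$ be a rank-one Lie group of Iwasawa type: a simply connected Lie group with a left-invariant Riemannian metric $g$ and solvable Lie algebra $\mathfrak s$ such that, with $\mathfrak n=[\mathfrak s,\mathfrak s]$ and $\mathfrak a=\mathfrak n^{\perp}$, the subspace $\mathfrak a$ is abelian with $\dim\mathfrak a=1$, the map $\operatorname{ad}(A')|_{\mathfrak n}$ is symmetric for all $A'\in\mathfrak a$, and it is positive definite for some $A'\in\mathfrak a$. Assume $\mathfrak n\neq 0$, and let $A\in\mathfrak a$ be the unit vector for which $\operatorname{ad}(A)|_{\mathfrak n}$ is positive definite. Let $0<\lambda_1<\dots<\lambda_m$ be the distinct eigenvalues of $\operatorname{ad}(A)|_{\mathfrak n}$, let $n_k$ be the dimensions of the eigenspaces, and put $n=\sum_k n_k\lambda_k$. Let $\tau=\sum_a(E_a^2-\nabla_{E_a}E_a)$ be the Laplace--Beltrami operator, where $(E_a)$ is an orthonormal frame of left-invariant vector fields. For an integer $p\ge 1$, a smooth function $\varphi:S\to\mathbb C$ is called proper $p$-harmonic if $\tau^p\varphi=0$ and $\tau^{p-1}\varphi\not\equiv 0$. There is a coordinate $t:S\to\mathbb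 R^+$, namely the Lie group homomorphism whose differential at the neutral element is $1$ on $A$ and $0$ on $\mathfrak n$ (the projection of $S=\mathbb R^+\ltimes N$ to its first factor). A smooth function on $S$ is called independent of $t$ if its derivative along the left-invariant vector field $A=t\,\partial/\partial t$ vanishes. For $i\ge 0$ let $I_i^m=\{1,\dots,m\}^i$. Let $h:S\to\mathbb C$ be smooth, independent of $t$ and not identically zero. Its tension tree is the collection of smooth functions $h^i_\alpha:S\to\mathbb C$, $i\ge1$, $\alpha\in I^m_i$, independent of $t$, such that $$\tau(h)=\sum_{k=1}^m h^1_k\,t^{2\lambda_k},\qquad \tau(h^i_\alpha)=\sum_{k=1}^m h^{i+1}_{(\alpha,k)}\,t^{2\lambda_k}\quad(i\ge1,\ \alpha\in I_i^m).$$ Suppose that it has finite degree $r$, i.e. $r\ge0$ is the smallest integer with $h^{r+1}_\alpha\equiv0$ for all $\alpha\in I^m_{r+1}$. For $\alpha\in I^m_i$ put $\Lambda^k_\alpha=\sum_{j=1}^k\lambda_{\alpha_j}$, $k=1,\dots,i$, and for $p\ge1$ $$f^i_{\alpha}(t,p)=\frac{t^{2\Lambda^i_\alpha}}{\prod_{k=1}^i\Lambda^k_\alpha}\sum_{j=0}^{p-1}\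 \sum_{\ell_1+\dots+\ell_i=j}\frac{(-1)^{i+j}\,2^{j-i}\prod_{k=1}^j(p-k)}{\prod_{k=1}^i(2\Lambda^k_\alpha-n)^{\ell_k+1}}\log(t)^{p-j-1},$$ $$g^i_{\alpha}(t,p)=\frac{t^{2\Lambda^i_\alpha+n}}{\prod_{k=1}^i\Lambda^k_\alpha}\sum_{j=0}^{p-1}\ \sum_{\ell_1+\dots+\ell_i=j}\frac{(-1)^{i+j}\,2^{j-i}\prod_{k=1}^j(p-k)}{\prod_{k=1}^i(2\Lambda^k_\alpha+n)^{\ell_k+1}}\log(t)^{p-j-1},$$ where the $\ell_k$ are non-negative integers, and define $$\phi_p=h\,\log(t)^{p-1}+\sum_{i=1}^r\sum_{\alpha\in I_i^m}h^i_\alpha\,f^i_\alpha(t,p),\qquad \psi_p=h\,t^n\log(t)^{p-1}+\sum_{i=1}^r\sum_{\alpha\in I_i^m}h^i_\alpha\,g^i_\alpha(t,p)$$ (terms with $h^i_\alpha\equiv0$ are zero). Then for every integer $p\ge1$ the function $\psi_p$ is proper $p$-harmonic on $S$. If moreover $\prod_{k=1}^i(2\Lambda^k_\alpha-n)\neq0$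 for all $i\ge1$ and $\alpha\in I_i^m$ with $h^i_\alpha\not\equiv0$, then $\phi_p$ is proper $p$-harmonic on $S$, and so is $a\phi_p+b\psi_p$ for every $(a,b)\in\mathbb C^2\setminus\{(0,0)\}$. -/

import Mathlib

open scoped Manifold ContDiff

noncomputable section

namespace IwasawaRankOne

section LieGroup

variable {d : ℕ} {S : Type*} [TopologicalSpace S] [ChartedSpace (EuclideanSpace ℝ (Fin d)) S]
  [Group S] [LieGroup (𝓡 d) ∞ S]

/-- The smoothness class in which Mathlib builds the Lie algebra of a Lie group. -/
instance instLieGroupMinSmoothness : LieGroup (𝓡 d) (minSmoothness ℝ 3) S := by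
  rw [minSmoothness_of_isRCLikeNormedField]
  infer_instance

variable (d S) in
/-- The Lie algebra `𝔰` of the Lie group `S`, with the bracket of left-invariant vector fields. -/
abbrev LieAlg : Type _ := GroupLieAlgebra (𝓡 d) S

instance instFiniteDimensionalLieAlg : FiniteDimensional ℝ (LieAlg d S) :=
  inferInstanceAs (FiniteDimensional ℝ (EuclideanSpace ℝ (Fin d)))

variable (d S) in
/-- Smooth Riemannian metrics on `S`. -/
abbrev Metric : Type _ :=
  Bundle.ContMDiffRiemannianMetric (𝓡 d) ∞ (EuclideanSpace ℝ (Fin d))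
    (fun x : S => TangentSpace (𝓡 d) x)

/-- All left translations `y ↦ x * y` are isometries of the metric. -/
def IsLeftInvariant (g : Metric d S) : Prop :=
  ∀ (x y : S) (v w : TangentSpace (𝓡 d) y),
    g.inner (x * y) (mfderiv (𝓡 d) (𝓡 d) (fun z : S => x * z) y v)
      (mfderiv (𝓡 d) (𝓡 d) (fun z : S => x * z) y w) = g.inner y v w

/-- The inner product on `𝔰` given by the metric at the neutral element. -/
def ip (g : Metric d S) (X Y : LieAlg d S) : ℝ := g.inner (1 : S) X Y

/-- `X φ`: the derivative of `φ : S → ℂ` along the left-invariant vector field with value `X` at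
the neutral element. -/
def lieDeriv (X : LieAlg d S) (φ : S → ℂ) (x : S) : ℂ :=
  mfderiv (𝓡 d) 𝓘(ℝ, ℂ) φ x (mulInvariantVectorField X x)

lemma exists_orthonormal_basis (g : Metric d S) :
    ∃ e : Module.Basis (Fin (Module.finrank ℝ (LieAlg d S))) ℝ (LieAlg d S),
      ∀ a b, ip g (e a) (e b) = if a = b then 1 else 0 := by
  let c : InnerProductSpace.Core ℝ (LieAlg d S) := g.toRiemannianMetric.toCore (1 : S)
  let _ : NormedAddCommGroup (LieAlg d S) := c.toNormedAddCommGroup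
  let _ : InnerProductSpace ℝ (LieAlg d S) := InnerProductSpace.ofCore c.toCore
  refine ⟨(stdOrthonormalBasis ℝ (LieAlg d S)).toBasis, fun a b => ?_⟩
  have h := orthonormal_iff_ite.mp (stdOrthonormalBasis ℝ (LieAlg d S)).orthonormal a b
  simp only [OrthonormalBasis.coe_toBasis]
  exact h

/-- An orthonormal basis of `𝔰`. -/
def onb (g : Metric d S) :
    Module.Basis (Fin (Module.finrank ℝ (LieAlg d S))) ℝ (LieAlg d S) :=
  (exists_orthonormal_basis g).choose

/-- The Levi-Civita connection of a left-invariant metric on left-invariant vector fields, given by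
the Koszul formula
`2⟨∇_X Y, Z⟩ = ⟨[X, Y], Z⟩ - ⟨[Y, Z], X⟩ + ⟨[Z, X], Y⟩`. -/
def leviCivita (g : Metric d S) (X Y : LieAlg d S) : LieAlg d S :=
  ∑ a, ((ip g ⁅X, Y⁆ (onb g a) - ip g ⁅Y, onb g a⁆ X + ip g ⁅onb g a, X⁆ Y) / 2) • onb g a

/-- The Laplace-Beltrami operator (tension field) of a left-invariant metric on complex-valued
functions, `τ = ∑ₐ (Eₐ² - ∇_{Eₐ} Eₐ)` for an orthonormal frame `(Eₐ)` of left-invariant vector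
fields. -/
def tau (g : Metric d S) (φ : S → ℂ) (x : S) : ℂ :=
  ∑ a, (lieDeriv (onb g a) (lieDeriv (onb g a) φ) x -
    lieDeriv (leviCivita g (onb g a) (onb g a)) φ x)

/-- `φ` is proper `p`-harmonic: it is smooth, `τ^p φ = 0` and `τ^(p-1) φ` does not vanish
identically. It is used for `p ≥ 1` only. -/
def IsProperPHarmonic (g : Metric d S) (p : ℕ) (φ : S → ℂ) : Prop :=
  ContMDiff (𝓡 d) 𝓘(ℝ, ℂ) ∞ φ ∧ (tau g)^[p] φ = 0 ∧ (tau g)^[p - 1] φ ≠ 0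

variable (d S) in
/-- `𝔫 = [𝔰, 𝔰]`. -/
abbrev nil : LieIdeal ℝ (LieAlg d S) :=
  ⁅(⊤ : LieIdeal ℝ (LieAlg d S)), (⊤ : LieIdeal ℝ (LieAlg d S))⁆

/-- `𝔞 = 𝔫^⊥`. -/
def aSub (g : Metric d S) : Submodule ℝ (LieAlg d S) where
  carrier := {X | ∀ Y ∈ nil d S, ip g X Y = 0}
  zero_mem' := fun Y _ => by simp [ip]
  add_mem' := fun {X X'} hX hX' Y hY => by
    have h1 := hX Y hY
    have h2 := hX' Y hY
    simp only [ip] at h1 h2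
    simp [ip, h1, h2]
  smul_mem' := fun c X hX Y hY => by
    have h1 := hX Y hY
    simp only [ip] at h1
    simp [ip, h1]

/-- `ad(A)|_𝔫` is positive definite. -/
def AdPosDef (g : Metric d S) (A : LieAlg d S) : Prop :=
  ∀ X ∈ nil d S, X ≠ 0 → 0 < ip g ⁅A, X⁆ X

/-- `(S, g)` is a Lie group of Iwasawa type. The orthogonal decomposition `𝔰 = 𝔞 ⊕ 𝔫` holds
by the definition of `𝔞` as `𝔫^⊥`. -/
structure IsIwasawaType [SimplyConnectedSpace S] (g : Metric d S) : Prop where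
  leftInvariant : IsLeftInvariant g
  solvable : LieAlgebra.IsSolvable (LieAlg d S)
  abelian : ∀ X ∈ aSub g, ∀ Y ∈ aSub g, ⁅X, Y⁆ = 0
  symm : ∀ A ∈ aSub g, ∀ X ∈ nil d S, ∀ Y ∈ nil d S, ip g ⁅A, X⁆ Y = ip g X ⁅A, Y⁆
  pos : ∃ A ∈ aSub g, AdPosDef g A

/-- The rank, `dim 𝔞`. -/
def rank (g : Metric d S) : ℕ := Module.finrank ℝ (aSub g)

/-- `A` is the unit vector of `𝔞` for which `ad(A)|_𝔫` is positive definite. -/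
structure IsUnitPositive (g : Metric d S) (A : LieAlg d S) : Prop where
  mem : A ∈ aSub g
  unit : ip g A A = 1
  pos : AdPosDef g A

/-- `ad(A)|_𝔫 : 𝔫 → 𝔫`. -/
def adN (A : LieAlg d S) : Module.End ℝ (nil d S) :=
  LieModule.toEnd ℝ (LieAlg d S) (nil d S) A

/-- The finite set `{λ₁, …, λ_m}` of the distinct eigenvalues of `ad(A)|_𝔫`. It replaces
`{1, …, m}` as the set of indices. -/
abbrev Eig (A : LieAlg d S) : Type := Module.End.Eigenvalues (adN A)

instance instFintypeEig (A : LieAlg d S) : Fintype (Eig A) := Fintype.ofFinite _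

/-- The eigenvalue `λ_k` as a real number. -/
def lam {A : LieAlg d S} (k : Eig A) : ℝ := k.1

/-- `n = ∑ n_k λ_k` with `n_k` the dimension of the eigenspace of `λ_k`. -/
def nn (A : LieAlg d S) : ℝ :=
  ∑ k : Eig A, (Module.finrank ℝ ((adN A).eigenspace (lam k)) : ℝ) * lam k

/-- `t` is the first coordinate of `S = ℝ⁺ ⋉ N`: the Lie group homomorphism
`t : S → ℝ⁺` whose differential at the neutral element is `1` on `A` and `0` on `𝔫`. -/
structure IsTCoordinate (A : LieAlg d S) (t : S → ℝ) : Prop where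
  pos : ∀ x, 0 < t x
  map_mul : ∀ x y, t (x * y) = t x * t y
  smooth : ContMDiff (𝓡 d) 𝓘(ℝ, ℝ) ∞ t
  deriv_A : (mfderiv (𝓡 d) 𝓘(ℝ, ℝ) t (1 : S) A : ℝ) = 1
  deriv_nil : ∀ X ∈ nil d S, (mfderiv (𝓡 d) 𝓘(ℝ, ℝ) t (1 : S) X : ℝ) = 0

/-- `h` does not depend on `t`. In the coordinates `(t, x)` of `S = ℝ⁺ ⋉ N` the left-invariant
vector field `A` is `t ∂/∂t`, so for smooth `h` this says that `h` is invariant along `A`. -/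
def IndepOfT (A : LieAlg d S) (h : S → ℂ) : Prop := ∀ x, lieDeriv A h x = 0

/-- The family `node i α`, for `i : ℕ` and multi-indices `α` of length `i`, is the tension tree of
`h`; the node at level `0` is `h` itself, and `Fin.snoc α k` is `(α, k)`. -/
structure IsTensionTree (g : Metric d S) (A : LieAlg d S) (t : S → ℝ) (h : S → ℂ)
    (node : (i : ℕ) → (Fin i → Eig A) → S → ℂ) : Prop where
  root : ∀ α, node 0 α = h
  smooth : ∀ i α, ContMDiff (𝓡 d) 𝓘(ℝ, ℂ) ∞ (node i α)
  indep : ∀ i α, IndepOfT A (node i α)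
  tension : ∀ i α x, tau g (node i α) x =
    ∑ k : Eig A, node (i + 1) (Fin.snoc α k : Fin (i + 1) → Eig A) x *
      (((t x) ^ (2 * lam k) : ℝ) : ℂ)

/-- The tension tree has finite degree `r`: the smallest `r` for which all nodes at level `r + 1`
vanish identically. -/
def HasDegree {A : LieAlg d S} (node : (i : ℕ) → (Fin i → Eig A) → S → ℂ) (r : ℕ) : Prop :=
  IsLeast {s : ℕ | ∀ α : Fin (s + 1) → Eig A, node (s + 1) α = 0} r

/-- `Λ^k_α = λ_{α_1} + … + λ_{α_k}`, where `k : Fin i` stands for the `(k + 1)`-st index. -/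
def Lam {A : LieAlg d S} {i : ℕ} (α : Fin i → Eig A) (k : Fin i) : ℝ :=
  ∑ j ∈ Finset.Iic k, lam (α j)

/-- `Λ^i_α`, the sum over the whole multi-index `α` of length `i`. -/
def LamTop {A : LieAlg d S} {i : ℕ} (α : Fin i → Eig A) : ℝ := ∑ j, lam (α j)

/-- `f^i_α(s, p)`. The inner sum is over all `ℓ : Fin i → ℕ` with `ℓ_1 + … + ℓ_i = j`. -/
def fFun {A : LieAlg d S} {i : ℕ} (α : Fin i → Eig A) (s : ℝ) (p : ℕ) : ℝ :=
  s ^ (2 * LamTop α) / (∏ k, Lam α k) *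
    ∑ j ∈ Finset.range p, ∑ ℓ ∈ Finset.Nat.antidiagonalTuple i j,
      ((-1 : ℝ) ^ (i + j) * (2 : ℝ) ^ ((j : ℤ) - (i : ℤ)) *
          ∏ k ∈ Finset.Icc 1 j, ((p : ℝ) - (k : ℝ))) /
        (∏ k, (2 * Lam α k - nn A) ^ (ℓ k + 1)) * Real.log s ^ (p - 1 - j)

/-- `g^i_α(s, p)`. -/
def gFun {A : LieAlg d S} {i : ℕ} (α : Fin i → Eig A) (s : ℝ) (p : ℕ) : ℝ :=
  s ^ (2 * LamTop α + nn A) / (∏ k, Lam α k) *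
    ∑ j ∈ Finset.range p, ∑ ℓ ∈ Finset.Nat.antidiagonalTuple i j,
      ((-1 : ℝ) ^ (i + j) * (2 : ℝ) ^ ((j : ℤ) - (i : ℤ)) *
          ∏ k ∈ Finset.Icc 1 j, ((p : ℝ) - (k : ℝ))) /
        (∏ k, (2 * Lam α k + nn A) ^ (ℓ k + 1)) * Real.log s ^ (p - 1 - j)

/-- `∏_k (2Λ^k_α - n) ≠ 0` for every node that does not vanish identically. -/
def NonDegenerate {A : LieAlg d S} (node : (i : ℕ) → (Fin i → Eig A) → S → ℂ) : Prop :=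
  ∀ (i : ℕ) (α : Fin i → Eig A), node i α ≠ 0 → ∏ k, (2 * Lam α k - nn A) ≠ 0

/-- `φ_p = h log(t)^(p-1) + ∑_{i=1}^r ∑_α h^i_α f^i_α(t, p)`. -/
def phi {A : LieAlg d S} (t : S → ℝ) (h : S → ℂ) (node : (i : ℕ) → (Fin i → Eig A) → S → ℂ)
    (r p : ℕ) (x : S) : ℂ :=
  h x * ((Real.log (t x) ^ (p - 1) : ℝ) : ℂ) +
    ∑ i ∈ Finset.Icc 1 r, ∑ α : Fin i → Eig A, node i α x * (fFun α (t x) p : ℂ)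

/-- `ψ_p = h t^n log(t)^(p-1) + ∑_{i=1}^r ∑_α h^i_α g^i_α(t, p)`. -/
def psi {A : LieAlg d S} (t : S → ℝ) (h : S → ℂ) (node : (i : ℕ) → (Fin i → Eig A) → S → ℂ)
    (r p : ℕ) (x : S) : ℂ :=
  h x * (((t x) ^ (nn A) * Real.log (t x) ^ (p - 1) : ℝ) : ℂ) +
    ∑ i ∈ Finset.Icc 1 r, ∑ α : Fin i → Eig A, node i α x * (gFun α (t x) p : ℂ)

end LieGroup

end IwasawaRankOne

end

/-! Put `u = log t`. In rank one `𝔰 = 𝔫 ⊕ ℝA`, and `tr ad` vanishes on `𝔫` and equals `n` at `A`, so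
`∑ ∇_{Eₐ}Eₐ = nA`. If `φ` is independent of `t`, the mixed term of `τ(φ F(u))` is a multiple of `Aφ
= 0`, and `τ(φ F(u)) = τ(φ) F(u) + φ (F'' - nF')(u)` (`IsLogCoordinate.tau_mul_comp`).

Both families are sums over the tension tree of `h^i_α F_α(u)` with `F_α = C_α e^{(2Λ_α + b)u}
P_q(u)`, where `q = p - 1`, `P_q` is an Appell polynomial, and `b` is a root of `b(b - n) = 0`: `b =
0` for `φ_p`, `b = n` for `ψ_p`. With `c = 2b - n` the coefficients solve `F'' - nF' = (terms in q-1
and q-2) - e^{2λ_k u} F_parent` (`nodeFun_ode_snoc`). The last term cancels what `τ` of the parent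
node contributes, the levels telescope, and finite degree closes the sum. Hence the tree sums `e_q`
satisfy `τ e_q = c q e_{q-1} + q(q-1) e_{q-2}` (`tau_treeSum`), just as `e^{bu}u^q` does under `∂² -
n∂`.

Since `c = ∓n` is nonzero, `τ^q e_q = c^q q! e_0` and `τ^{q+1} e_q = 0`. Properness, also of
combinations, thus reduces to the linear independence of `φ_1` and `ψ_1`, which follows from that of
exponentials in `u` over functions independent of `t` (`treeSum_zero_comb_ne_zero`).

The coordinate `t` exists because `|det Ad|^{1/n}` is a homomorphism whose differential at the
identity is `tr ad / n`. This needs `d Ad = ad` for the bracket of left-invariant fields, which is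
checked in a chart. -/

set_option linter.unusedSectionVars false

noncomputable section

namespace IwasawaRankOne

/-! ### Second-order calculus of a local group law -/

section Calculus

open Filter Topology

variable {E : Type*} [NormedAddCommGroup E] [NormedSpace ℝ E]

/-- The derivative of a local conjugation `c` with respect to its first argument, in terms of the
local group law `q`. -/
lemma fderiv_conj_eq_lieBracket {q c : E × E → E} {p : E} (hq : ContDiffAt ℝ ∞ q (p, p))
    (hc : ContDiffAt ℝ ∞ c (p, p)) (hqc : ∀ᶠ z in 𝓝 (p, p), q z = q (c z, z.1))
    (hql : ∀ᶠ b in 𝓝 p, q (p, b) = b) (hqr : ∀ᶠ a in 𝓝 p, q (a, p) = a)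
    (hcp : ∀ᶠ a in 𝓝 p, c (a, p) = p) (hcl : ∀ᶠ b in 𝓝 p, c (p, b) = b) (X Y : E) :
    fderiv ℝ (fun a => (fderiv ℝ c (a, p)).comp (ContinuousLinearMap.inr ℝ E E)) p X Y =
      VectorField.lieBracket ℝ (fun a => fderiv ℝ q (a, p) (0, X))
        (fun a => fderiv ℝ q (a, p) (0, Y)) p := by
  have hdq : ∀ᶠ z in 𝓝 (p, p), DifferentiableAt ℝ q z :=
    (hq.of_le (m := 1) (by simp)).eventually (by simp) |>.mono
      fun z hz => hz.differentiableAt (by simp)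
  have hdc : ∀ᶠ z in 𝓝 (p, p), DifferentiableAt ℝ c z :=
    (hc.of_le (m := 1) (by simp)).eventually (by simp) |>.mono
      fun z hz => hz.differentiableAt (by simp)
  have hDq : DifferentiableAt ℝ (fderiv ℝ q) (p, p) :=
    (hq.fderiv_right (m := ∞) (by simp)).differentiableAt (by simp)
  have hDc : DifferentiableAt ℝ (fderiv ℝ c) (p, p) :=
    (hc.fderiv_right (m := ∞) (by simp)).differentiableAt (by simp)
  have hl : HasFDerivAt (fun a : E => (a, p)) (ContinuousLinearMap.inl ℝ E E) p :=
    hasFDerivAt_prodMk_left p p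
  have hr : HasFDerivAt (fun a : E => (p, a)) (ContinuousLinearMap.inr ℝ E E) p :=
    hasFDerivAt_prodMk_right p p
  have tl : Tendsto (fun a : E => (a, p)) (𝓝 p) (𝓝 (p, p)) := hl.continuousAt
  have tr : Tendsto (fun a : E => (p, a)) (𝓝 p) (𝓝 (p, p)) := hr.continuousAt
  set D := fderiv ℝ (fderiv ℝ q) (p, p) with hD
  have hV : ∀ Z, HasFDerivAt (fun a => fderiv ℝ q (a, p) (0, Z))
      ((ContinuousLinearMap.apply ℝ E ((0, Z) : E × E)).comp
        (D.comp (ContinuousLinearMap.inl ℝ E E))) p := fun Z =>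
    (ContinuousLinearMap.apply ℝ E ((0, Z) : E × E)).hasFDerivAt.comp p
      (HasFDerivAt.comp p (f := fun a : E => (a, p)) hDq.hasFDerivAt hl)
  have hq2 : ∀ Z, fderiv ℝ q (p, p) (0, Z) = Z := fun Z => by
    have h1 := (HasFDerivAt.comp p (f := fun a : E => (p, a)) hdq.self_of_nhds.hasFDerivAt hr)
    have h2 : HasFDerivAt (fun b => q (p, b)) (ContinuousLinearMap.id ℝ E) p :=
      (hasFDerivAt_id p).congr_of_eventuallyEq hql
    exact congrArg (· Z) (h1.unique h2)
  have hq1 : ∀ Z, fderiv ℝ q (p, p) (Z, 0) = Z := fun Z => by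
    have h1 := (HasFDerivAt.comp p (f := fun a : E => (a, p)) hdq.self_of_nhds.hasFDerivAt hl)
    have h2 : HasFDerivAt (fun b => q (b, p)) (ContinuousLinearMap.id ℝ E) p :=
      (hasFDerivAt_id p).congr_of_eventuallyEq hqr
    exact congrArg (· Z) (h1.unique h2)
  have hc2 : fderiv ℝ c (p, p) (0, Y) = Y := by
    have h1 := (HasFDerivAt.comp p (f := fun a : E => (p, a)) hdc.self_of_nhds.hasFDerivAt hr)
    have h2 : HasFDerivAt (fun b => c (p, b)) (ContinuousLinearMap.id ℝ E) p :=
      (hasFDerivAt_id p).congr_of_eventuallyEq hcl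
    exact congrArg (· Y) (h1.unique h2)
  -- the derivative of `c` in its first argument
  have hC : HasFDerivAt (fun a => (fderiv ℝ c (a, p)).comp (ContinuousLinearMap.inr ℝ E E))
      (fderiv ℝ (fun a => (fderiv ℝ c (a, p)).comp (ContinuousLinearMap.inr ℝ E E)) p) p := by
    refine DifferentiableAt.hasFDerivAt ?_
    exact (hDc.comp p (f := fun a : E => (a, p)) hl.differentiableAt).clm_comp
      (differentiableAt_const _)
  set C' := fderiv ℝ (fun a => (fderiv ℝ c (a, p)).comp (ContinuousLinearMap.inr ℝ E E)) p
  -- This is the derivative in `b`, at `b = p`, of the identity `ab = (aba⁻¹)a`.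
  have key : ∀ᶠ a in 𝓝 p, fderiv ℝ q (a, p) (0, Y) =
      fderiv ℝ q (p, a) (((fderiv ℝ c (a, p)).comp (ContinuousLinearMap.inr ℝ E E)) Y, 0) := by
    have hqc' : ∀ᶠ a in 𝓝 p, ∀ᶠ b in 𝓝 p, q (a, b) = q (c (a, b), a) := hqc.curry_nhds
    filter_upwards [hqc', tl.eventually hdq, tr.eventually hdq, tl.eventually hdc, hcp] with
      a h1 h2 h3 h4 h5
    have hra : HasFDerivAt (fun b : E => (a, b)) (ContinuousLinearMap.inr ℝ E E) p :=
      hasFDerivAt_prodMk_right a p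
    have e1 := HasFDerivAt.comp p (f := fun b : E => (a, b)) h2.hasFDerivAt hra
    have e2 := HasFDerivAt.comp p (f := fun b : E => (a, b)) h4.hasFDerivAt hra
    have e3 : HasFDerivAt (fun b : E => (c (a, b), a)) _ p := e2.prodMk (hasFDerivAt_const a p)
    have h3' : HasFDerivAt q (fderiv ℝ q (p, a)) (c (a, p), a) := by
      rw [h5]; exact h3.hasFDerivAt
    have e4 := HasFDerivAt.comp p (f := fun b : E => (c (a, b), a)) h3' e3
    have e5 := e1.congr_of_eventuallyEq (f₁ := fun b : E => q (c (a, b), a))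
      (h1.mono fun b hb => hb.symm)
    exact congrArg (· Y) (e5.unique e4)
  have hR : HasFDerivAt (fun a => fderiv ℝ q (p, a)
      (((fderiv ℝ c (a, p)).comp (ContinuousLinearMap.inr ℝ E E)) Y, 0)) _ p :=
    (HasFDerivAt.comp p (f := fun a : E => (p, a)) hDq.hasFDerivAt hr).clm_apply
      ((hC.clm_apply (hasFDerivAt_const Y p)).prodMk (hasFDerivAt_const (0 : E) p))
  -- Differentiating `key` in `a` along `X` gives `D²q((X,0),(0,Y)) = D²q((0,X),(Y,0)) + C'XY`.
  -- Symmetry of `D²q` turns the difference of the second derivatives into the Lie bracket.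
  have hfin := congrArg (· X) ((hV Y).unique (hR.congr_of_eventuallyEq key))
  have hsymm : IsSymmSndFDerivAt ℝ q (p, p) :=
    hq.isSymmSndFDerivAt (by simp [minSmoothness_of_isRCLikeNormedField]; exact ENat.LEInfty.out)
  have hs := hsymm.eq (0, X) (Y, 0)
  simp [hq1, hc2] at hfin
  simp only [VectorField.lieBracket, (hV _).fderiv, hq2]
  simp only [ContinuousLinearMap.comp_apply, ContinuousLinearMap.inl_apply,
    ContinuousLinearMap.apply_apply]
  rw [← hD] at hs
  rw [hfin, ← hs]
  abel

end Calculus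

/-! ### The adjoint representation and left-invariant fields in the chart at the identity -/

section Adjoint

open Filter Topology

variable {d : ℕ} {S : Type*} [TopologicalSpace S] [ChartedSpace (EuclideanSpace ℝ (Fin d)) S]
  [Group S] [LieGroup (𝓡 d) ∞ S]

local notation "E" => EuclideanSpace ℝ (Fin d)

variable (d S) in
/-- The group law in the chart at the neutral element. -/
def chartMul (z : E × E) : E :=
  extChartAt (𝓡 d) (1 : S) ((extChartAt (𝓡 d) (1 : S)).symm z.1 *
    (extChartAt (𝓡 d) (1 : S)).symm z.2)

variable (d S) in
/-- Conjugation in the chart at the neutral element. -/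
def chartConj (z : E × E) : E :=
  extChartAt (𝓡 d) (1 : S) ((extChartAt (𝓡 d) (1 : S)).symm z.1 *
    (extChartAt (𝓡 d) (1 : S)).symm z.2 * ((extChartAt (𝓡 d) (1 : S)).symm z.1)⁻¹)

variable (d) in
/-- The adjoint representation. -/
def Ad (x : S) : LieAlg d S →L[ℝ] LieAlg d S :=
  (mfderiv (𝓡 d) (𝓡 d) (fun y : S => x * y * x⁻¹) 1 : E →L[ℝ] E)

variable (d S) in
/-- The coordinate of the neutral element. -/
abbrev chartOne : E := extChartAt (𝓡 d) (1 : S) 1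

lemma chart_symm_one : (extChartAt (𝓡 d) (1 : S)).symm (chartOne d S) = 1 :=
  extChartAt_to_inv 1

lemma contMDiffAt_chart_symm {a : E} (ha : a ∈ (extChartAt (𝓡 d) (1 : S)).target) :
    ContMDiffAt 𝓘(ℝ, E) (𝓡 d) ∞ (extChartAt (𝓡 d) (1 : S)).symm a :=
  (contMDiffOn_extChartAt_symm (n := ∞) (1 : S)).contMDiffAt
    ((isOpen_extChartAt_target (1 : S)).mem_nhds ha)

lemma contMDiff_conj (x : S) : ContMDiff (𝓡 d) (𝓡 d) ∞ (fun y : S => x * y * x⁻¹) :=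
  (contMDiff_mul_right (I := 𝓡 d) (n := ∞) (a := x⁻¹)).comp
    (contMDiff_mul_left (I := 𝓡 d) (n := ∞) (a := x))

lemma hasMFDerivAt_conj (x : S) :
    HasMFDerivAt (𝓡 d) (𝓡 d) (fun y : S => x * y * x⁻¹) 1 (Ad d x) :=
  (((contMDiff_conj (d := d) x).mdifferentiable (by simp)) 1).hasMFDerivAt

lemma Ad_mul (x y : S) : Ad d (x * y) = (Ad d x).comp (Ad d y) := by
  have h : (fun z : S => x * y * z * (x * y)⁻¹) =
      (fun z : S => x * z * x⁻¹) ∘ (fun z : S => y * z * y⁻¹) := by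
    funext z; simp [mul_assoc]
  have h1 : HasMFDerivAt (𝓡 d) (𝓡 d) (fun z : S => x * z * x⁻¹) (y * 1 * y⁻¹) (Ad d x) := by
    rw [mul_one, mul_inv_cancel]
    exact hasMFDerivAt_conj x
  have h2 := HasMFDerivAt.comp (1 : S) (f := fun z : S => y * z * y⁻¹) h1 (hasMFDerivAt_conj y)
  rw [← h] at h2
  exact hasMFDerivAt_unique (hasMFDerivAt_conj (x * y)) h2

lemma Ad_one : Ad d (1 : S) = ContinuousLinearMap.id ℝ (LieAlg d S) := by
  have h : (fun z : S => 1 * z * 1⁻¹) = id := by funext z; simp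
  unfold Ad
  rw [h, mfderiv_id]

lemma contDiffAt_chartMul : ContDiffAt ℝ ∞ (chartMul d S) (chartOne d S, chartOne d S) := by
  have ht : chartOne d S ∈ (extChartAt (𝓡 d) (1 : S)).target := mem_extChartAt_target (1 : S)
  rw [← contMDiffAt_iff_contDiffAt]
  have h1 : ContMDiffAt 𝓘(ℝ, E × E) (𝓡 d) ∞
      (fun z : E × E => (extChartAt (𝓡 d) (1 : S)).symm z.1) (chartOne d S, chartOne d S) :=
    ContMDiffAt.comp (chartOne d S, chartOne d S) (contMDiffAt_chart_symm ht)
      contDiffAt_fst.contMDiffAt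
  have h2 : ContMDiffAt 𝓘(ℝ, E × E) (𝓡 d) ∞
      (fun z : E × E => (extChartAt (𝓡 d) (1 : S)).symm z.2) (chartOne d S, chartOne d S) :=
    ContMDiffAt.comp (chartOne d S, chartOne d S) (contMDiffAt_chart_symm ht)
      contDiffAt_snd.contMDiffAt
  refine ContMDiffAt.comp _ (contMDiffAt_extChartAt' ?_) (h1.mul h2)
  simpa only [chart_symm_one, mul_one, inv_one] using mem_chart_source E (1 : S)

lemma contDiffAt_chartConj : ContDiffAt ℝ ∞ (chartConj d S) (chartOne d S, chartOne d S) := by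
  have ht : chartOne d S ∈ (extChartAt (𝓡 d) (1 : S)).target := mem_extChartAt_target (1 : S)
  rw [← contMDiffAt_iff_contDiffAt]
  have h1 : ContMDiffAt 𝓘(ℝ, E × E) (𝓡 d) ∞
      (fun z : E × E => (extChartAt (𝓡 d) (1 : S)).symm z.1) (chartOne d S, chartOne d S) :=
    ContMDiffAt.comp (chartOne d S, chartOne d S) (contMDiffAt_chart_symm ht)
      contDiffAt_fst.contMDiffAt
  have h2 : ContMDiffAt 𝓘(ℝ, E × E) (𝓡 d) ∞
      (fun z : E × E => (extChartAt (𝓡 d) (1 : S)).symm z.2) (chartOne d S, chartOne d S) :=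
    ContMDiffAt.comp (chartOne d S, chartOne d S) (contMDiffAt_chart_symm ht)
      contDiffAt_snd.contMDiffAt
  refine ContMDiffAt.comp _ (contMDiffAt_extChartAt' ?_) ((h1.mul h2).mul h1.inv)
  simpa only [chart_symm_one, mul_one, inv_one] using mem_chart_source E (1 : S)

/-- Near the neutral element the adjoint representation is given by the derivative of conjugation
in the chart. -/
lemma Ad_chart_symm : ∀ᶠ a in 𝓝 (chartOne d S), ∀ Y : E,
    (Ad d ((extChartAt (𝓡 d) (1 : S)).symm a) : E →L[ℝ] E) Y =
      fderiv ℝ (chartConj d S) (a, chartOne d S) (0, Y) := by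
  have hd : ∀ᶠ z in 𝓝 (chartOne d S, chartOne d S), DifferentiableAt ℝ (chartConj d S) z :=
    (contDiffAt_chartConj.of_le (m := 1) (by simp)).eventually (by simp) |>.mono
      fun z hz => hz.differentiableAt (by simp)
  have tl : Tendsto (fun a : E => (a, chartOne d S)) (𝓝 (chartOne d S))
    (𝓝 (chartOne d S, chartOne d S)) := Continuous.tendsto (by fun_prop) _
  filter_upwards [tl.eventually hd] with a ha Y
  set x := (extChartAt (𝓡 d) (1 : S)).symm a with hx
  have e1 := HasFDerivAt.comp (chartOne d S) (f := fun b : E => (a, b)) ha.hasFDerivAt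
    (hasFDerivAt_prodMk_right a (chartOne d S))
  have ht : chartOne d S ∈ (extChartAt (𝓡 d) (1 : S)).target := mem_extChartAt_target (1 : S)
  have d1 : HasMFDerivAt 𝓘(ℝ, E) (𝓡 d) (extChartAt (𝓡 d) (1 : S)).symm (chartOne d S)
      (ContinuousLinearMap.id ℝ E) := by
    have h := ((contMDiffAt_chart_symm ht).mdifferentiableAt (by simp)).hasMFDerivAt
    have h' := mfderivWithin_range_extChartAt_symm (I := 𝓡 d) (x := (1 : S))
    rw [ModelWithCorners.range_eq_univ, mfderivWithin_univ] at h'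
    rw [h'] at h
    exact h
  have d2 : HasMFDerivAt (𝓡 d) (𝓡 d) (fun y : S => x * y * x⁻¹)
      ((extChartAt (𝓡 d) (1 : S)).symm (chartOne d S)) (Ad d x) := by
    rw [chart_symm_one]
    exact hasMFDerivAt_conj x
  have d3 : HasMFDerivAt (𝓡 d) 𝓘(ℝ, E) (extChartAt (𝓡 d) (1 : S))
      (x * (extChartAt (𝓡 d) (1 : S)).symm (chartOne d S) * x⁻¹)
      (ContinuousLinearMap.id ℝ E) := by
    rw [chart_symm_one, mul_one, mul_inv_cancel]
    have h := (mdifferentiableAt_extChartAt (I := 𝓡 d) (mem_chart_source E (1 : S))).hasMFDerivAt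
    rw [mfderiv_extChartAt_self] at h
    exact h
  have d4 := HasMFDerivAt.comp (chartOne d S)
    (f := fun b => x * (extChartAt (𝓡 d) (1 : S)).symm b * x⁻¹) d3
    (HasMFDerivAt.comp (chartOne d S) (f := (extChartAt (𝓡 d) (1 : S)).symm)
      (g := fun y : S => x * y * x⁻¹) d2 d1)
  -- Quantifying over `T` moves the derivative from tangent spaces to the model space, where
  -- uniqueness of Fréchet derivatives applies.
  have e2 : ∀ T : E →L[ℝ] E, T = Ad d x →
      HasFDerivAt (fun b : E => chartConj d S (a, b)) T (chartOne d S) := by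
    rintro _ rfl
    exact hasMFDerivAt_iff_hasFDerivAt.1 d4
  exact congrArg (fun T : E →L[ℝ] E => T Y) ((e2 _ rfl).unique e1)

/-- A left-invariant field is the derivative of multiplication in its second factor. Here the
inverse of the differential of the inverse chart is the differential of the chart. -/
lemma mpullback_chart_symm : ∀ᶠ a in 𝓝 (chartOne d S), ∀ Y : LieAlg d S,
    VectorField.mpullback 𝓘(ℝ, E) (𝓡 d) (extChartAt (𝓡 d) (1 : S)).symm
      (mulInvariantVectorField Y) a = fderiv ℝ (chartMul d S) (a, chartOne d S) (0, Y) := by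
  have hd : ∀ᶠ z in 𝓝 (chartOne d S, chartOne d S), DifferentiableAt ℝ (chartMul d S) z :=
    (contDiffAt_chartMul.of_le (m := 1) (by simp)).eventually (by simp) |>.mono
      fun z hz => hz.differentiableAt (by simp)
  have tl : Tendsto (fun a : E => (a, chartOne d S)) (𝓝 (chartOne d S))
    (𝓝 (chartOne d S, chartOne d S)) := Continuous.tendsto (by fun_prop) _
  filter_upwards [tl.eventually hd, extChartAt_target_mem_nhds (1 : S)] with a ha hta Y
  set x := (extChartAt (𝓡 d) (1 : S)).symm a with hx
  have e1 := HasFDerivAt.comp (chartOne d S) (f := fun b : E => (a, b)) ha.hasFDerivAt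
    (hasFDerivAt_prodMk_right a (chartOne d S))
  have ht : chartOne d S ∈ (extChartAt (𝓡 d) (1 : S)).target := mem_extChartAt_target (1 : S)
  have d1 : HasMFDerivAt 𝓘(ℝ, E) (𝓡 d) (extChartAt (𝓡 d) (1 : S)).symm (chartOne d S)
      (ContinuousLinearMap.id ℝ E) := by
    have h := ((contMDiffAt_chart_symm ht).mdifferentiableAt (by simp)).hasMFDerivAt
    have h' := mfderivWithin_range_extChartAt_symm (I := 𝓡 d) (x := (1 : S))
    rw [ModelWithCorners.range_eq_univ, mfderivWithin_univ] at h'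
    rw [h'] at h
    exact h
  have d2 : HasMFDerivAt (𝓡 d) (𝓡 d) (fun y : S => x * y)
      ((extChartAt (𝓡 d) (1 : S)).symm (chartOne d S))
      (mfderiv (𝓡 d) (𝓡 d) (fun y : S => x * y) 1 : E →L[ℝ] E) := by
    rw [chart_symm_one]
    exact (((contMDiff_mul_left (I := 𝓡 d) (n := ∞) (a := x)).mdifferentiable
      (by simp)) 1).hasMFDerivAt
  have hxs : x ∈ (extChartAt (𝓡 d) (1 : S)).source := (extChartAt (𝓡 d) (1 : S)).map_target hta
  have d3 : HasMFDerivAt (𝓡 d) 𝓘(ℝ, E) (extChartAt (𝓡 d) (1 : S))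
      (x * (extChartAt (𝓡 d) (1 : S)).symm (chartOne d S))
      (mfderiv (𝓡 d) 𝓘(ℝ, E) (extChartAt (𝓡 d) (1 : S)) x : E →L[ℝ] E) := by
    rw [chart_symm_one, mul_one]
    rw [extChartAt_source] at hxs
    exact (mdifferentiableAt_extChartAt (I := 𝓡 d) hxs).hasMFDerivAt
  have d4 := HasMFDerivAt.comp (chartOne d S)
    (f := fun b => x * (extChartAt (𝓡 d) (1 : S)).symm b) d3
    (HasMFDerivAt.comp (chartOne d S) (f := (extChartAt (𝓡 d) (1 : S)).symm)
      (g := fun y : S => x * y) d2 d1)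
  have e2 : ∀ T : E →L[ℝ] E, T = (mfderiv (𝓡 d) 𝓘(ℝ, E) (extChartAt (𝓡 d) (1 : S)) x).comp
        (mfderiv (𝓡 d) (𝓡 d) (fun y : S => x * y) 1 : E →L[ℝ] E) →
      HasFDerivAt (fun b : E => chartMul d S (a, b)) T (chartOne d S) := by
    rintro _ rfl
    exact hasMFDerivAt_iff_hasFDerivAt.1 d4
  have h1 := mfderiv_extChartAt_comp_mfderivWithin_extChartAt_symm (I := 𝓡 d) (x := (1 : S)) hta
  have h2 := mfderivWithin_extChartAt_symm_comp_mfderiv_extChartAt (I := 𝓡 d) (x := (1 : S)) hta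
  rw [ModelWithCorners.range_eq_univ, mfderivWithin_univ] at h1 h2
  rw [VectorField.mpullback_apply, ContinuousLinearMap.inverse_eq h2 h1]
  exact congrArg (fun T : E →L[ℝ] E => T Y) ((e2 _ rfl).unique e1)

end Adjoint

/-! ### The determinant and its derivative at the identity -/

section Determinant

variable {V : Type*} [NormedAddCommGroup V] [NormedSpace ℝ V] [FiniteDimensional ℝ V]

lemma contDiff_clm_det : ContDiff ℝ ∞ (fun T : V →L[ℝ] V => LinearMap.det (T : V →ₗ[ℝ] V)) := by
  let b := Module.finBasis ℝ V
  have h : (fun T : V →L[ℝ] V => LinearMap.det (T : V →ₗ[ℝ] V)) = fun T : V →L[ℝ] V =>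
      ∑ σ : Equiv.Perm (Fin (Module.finrank ℝ V)), ((Equiv.Perm.sign σ : ℤ) : ℝ) *
        ∏ i, LinearMap.toContinuousLinearMap (b.coord (σ i)) (T (b i)) := by
    funext T
    rw [← LinearMap.det_toMatrix b, Matrix.det_apply']
    simp [LinearMap.toMatrix_apply]
  rw [h]
  refine ContDiff.sum fun σ _ => contDiff_const.mul (contDiff_prod fun i _ => ?_)
  exact (ContinuousLinearMap.contDiff _).comp (contDiff_id.clm_apply contDiff_const)

/-- Along the line `1 + sM` the determinant is a polynomial `1 + s tr M + s² R(s)`. -/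
lemma fderiv_clm_det_id (M : V →L[ℝ] V) :
    fderiv ℝ (fun T : V →L[ℝ] V => LinearMap.det (T : V →ₗ[ℝ] V))
      (ContinuousLinearMap.id ℝ V) M = LinearMap.trace ℝ V M := by
  let b := Module.finBasis ℝ V
  have h1 : HasDerivAt (fun s : ℝ => ContinuousLinearMap.id ℝ V + s • M) M 0 := by
    simpa using ((hasDerivAt_id (0 : ℝ)).smul_const M).const_add (ContinuousLinearMap.id ℝ V)
  have h2 := (contDiff_clm_det (V := V)).differentiable (by simp)
    (ContinuousLinearMap.id ℝ V + (0 : ℝ) • M)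
  have h3 := h2.hasFDerivAt.comp_hasDerivAt (0 : ℝ) h1
  rw [zero_smul, add_zero] at h3
  have h4 : HasDerivAt ((fun T : V →L[ℝ] V => LinearMap.det (T : V →ₗ[ℝ] V)) ∘
      fun s : ℝ => ContinuousLinearMap.id ℝ V + s • M) (LinearMap.trace ℝ V M) 0 := by
    have h5 : ((fun T : V →L[ℝ] V => LinearMap.det (T : V →ₗ[ℝ] V)) ∘
        fun s : ℝ => ContinuousLinearMap.id ℝ V + s • M) = fun s : ℝ =>
        1 + LinearMap.trace ℝ V M * s + ((Matrix.det (1 + (Polynomial.X : Polynomial ℝ) •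
          (LinearMap.toMatrix b b (M : V →ₗ[ℝ] V)).map Polynomial.C)).divX.divX).eval s * s ^ 2 := by
      funext s
      simp only [Function.comp]
      rw [← LinearMap.det_toMatrix b, LinearMap.trace_eq_matrix_trace ℝ b,
        ← Matrix.det_one_add_smul]
      simp
    rw [h5]
    have h6 := (((hasDerivAt_id (0 : ℝ)).const_mul (LinearMap.trace ℝ V M)).const_add 1).add
      (((Polynomial.hasDerivAt (Matrix.det (1 + (Polynomial.X : Polynomial ℝ) •
          (LinearMap.toMatrix b b (M : V →ₗ[ℝ] V)).map Polynomial.C)).divX.divX (0 : ℝ))).mul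
          (hasDerivAt_pow 2 (0 : ℝ)))
    refine h6.congr_deriv ?_
    simp
  exact h3.unique h4

end Determinant

/-! ### The modular function and the existence of `t` -/

section ModularFunction

open Filter Topology

variable {d : ℕ} {S : Type*} [TopologicalSpace S] [ChartedSpace (EuclideanSpace ℝ (Fin d)) S]
  [Group S] [LieGroup (𝓡 d) ∞ S]

local notation "E" => EuclideanSpace ℝ (Fin d)

lemma lie_eq_lieBracket_chartMul (X Y : LieAlg d S) :
    ⁅X, Y⁆ = VectorField.lieBracket ℝ
      (fun a => fderiv ℝ (chartMul d S) (a, chartOne d S) (0, X))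
      (fun a => fderiv ℝ (chartMul d S) (a, chartOne d S) (0, Y)) (chartOne d S) := by
  rw [GroupLieAlgebra.bracket_def, ← VectorField.mlieBracketWithin_univ,
    VectorField.mlieBracketWithin_apply]
  have h0 : ∀ v : E, (mfderiv (𝓡 d) 𝓘(ℝ, E) (extChartAt (𝓡 d) (1 : S)) 1 :
      E →L[ℝ] E).inverse v = v := fun v =>
    (congrArg (fun T : E →L[ℝ] E => T.inverse v) mfderiv_extChartAt_self).trans
      (congrArg (fun T : E →L[ℝ] E => T v) ContinuousLinearMap.inverse_id)
  refine (h0 _).trans ?_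
  simp only [ModelWithCorners.range_eq_univ, Set.preimage_univ, Set.univ_inter,
    VectorField.mpullbackWithin_univ]
  refine (congrFun VectorField.lieBracketWithin_univ (chartOne d S)).trans ?_
  exact Filter.EventuallyEq.lieBracket_vectorField_eq
    (mpullback_chart_symm.mono fun a ha => ha X) (mpullback_chart_symm.mono fun a ha => ha Y)

/-- This is `d Ad = ad`, obtained from the local group law. -/
lemma fderiv_Ad_chart (X Y : LieAlg d S) :
    fderiv ℝ (fun a => (fderiv ℝ (chartConj d S) (a, chartOne d S)).comp
      (ContinuousLinearMap.inr ℝ E E)) (chartOne d S) X Y = ⁅X, Y⁆ := by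
  rw [lie_eq_lieBracket_chartMul]
  have ht := extChartAt_target_mem_nhds (I := 𝓡 d) (1 : S)
  have : IsTopologicalGroup S := topologicalGroup_of_lieGroup (𝓡 d) ∞
  have hcs : ContinuousAt (extChartAt (𝓡 d) (1 : S)).symm (chartOne d S) :=
    continuousAt_extChartAt_symm (1 : S)
  have hri : ∀ᶠ a in 𝓝 (chartOne d S), extChartAt (𝓡 d) (1 : S)
      ((extChartAt (𝓡 d) (1 : S)).symm a) = a := by
    filter_upwards [ht] with a ha using (extChartAt (𝓡 d) (1 : S)).right_inv ha
  refine fderiv_conj_eq_lieBracket contDiffAt_chartMul contDiffAt_chartConj ?_ ?_ ?_ ?_ ?_ X Y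
  -- The identity `ab = (aba⁻¹)a` can be read in the chart only where `aba⁻¹` lies in its domain,
  -- which holds near the identity by continuity.
  · have h1 : Tendsto (fun z : E × E => (extChartAt (𝓡 d) (1 : S)).symm z.1 *
        (extChartAt (𝓡 d) (1 : S)).symm z.2 * ((extChartAt (𝓡 d) (1 : S)).symm z.1)⁻¹)
        (𝓝 (chartOne d S, chartOne d S)) (𝓝 (1 : S)) := by
      have h2 : Tendsto (fun z : E × E => (extChartAt (𝓡 d) (1 : S)).symm z.1)
        (𝓝 (chartOne d S, chartOne d S)) (𝓝 (1 : S)) := by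
        have := hcs.tendsto.comp (continuous_fst.tendsto (chartOne d S, chartOne d S))
        rwa [chart_symm_one] at this
      have h3 : Tendsto (fun z : E × E => (extChartAt (𝓡 d) (1 : S)).symm z.2)
        (𝓝 (chartOne d S, chartOne d S)) (𝓝 (1 : S)) := by
        have := hcs.tendsto.comp (continuous_snd.tendsto (chartOne d S, chartOne d S))
        rwa [chart_symm_one] at this
      simpa using (h2.mul h3).mul h2.inv
    filter_upwards [h1.eventually (extChartAt_source_mem_nhds (I := 𝓡 d) (1 : S))] with z hz
    simp only [chartMul, chartConj]
    rw [(extChartAt (𝓡 d) (1 : S)).left_inv hz]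
    simp
  · filter_upwards [hri] with b hb
    simp only [chartMul, chart_symm_one, one_mul, hb]
  · filter_upwards [hri] with b hb
    simp only [chartMul, chart_symm_one, mul_one, hb]
  · filter_upwards with a
    simp only [chartConj, chart_symm_one, mul_one, mul_inv_cancel]
  · filter_upwards [hri] with b hb
    simp only [chartConj, chart_symm_one, one_mul, inv_one, mul_one, hb]

/-- The logarithm of the modular function. -/
def logModular (x : S) : ℝ := Real.log (LinearMap.det (Ad d x : LieAlg d S →ₗ[ℝ] LieAlg d S))

lemma det_Ad_mul (x y : S) : LinearMap.det (Ad d (x * y) : LieAlg d S →ₗ[ℝ] LieAlg d S) =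
    LinearMap.det (Ad d x : LieAlg d S →ₗ[ℝ] LieAlg d S) *
      LinearMap.det (Ad d y : LieAlg d S →ₗ[ℝ] LieAlg d S) := by
  rw [Ad_mul, ← LinearMap.det_comp]
  rfl

lemma det_Ad_one : LinearMap.det (Ad d (1 : S) : LieAlg d S →ₗ[ℝ] LieAlg d S) = 1 := by
  rw [Ad_one]
  exact LinearMap.det_id

lemma det_Ad_ne_zero (x : S) : LinearMap.det (Ad d x : LieAlg d S →ₗ[ℝ] LieAlg d S) ≠ 0 := by
  intro h
  have h1 := det_Ad_mul (d := d) x x⁻¹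
  rw [h, zero_mul, mul_inv_cancel, det_Ad_one] at h1
  exact one_ne_zero h1

/-- `Real.log` is `log|·|`, so a nonzero determinant suffices and its sign plays no role. -/
lemma logModular_mul (x y : S) :
    logModular (d := d) (x * y) = logModular (d := d) x + logModular (d := d) y := by
  rw [logModular, det_Ad_mul, Real.log_mul (det_Ad_ne_zero x) (det_Ad_ne_zero y)]
  rfl

lemma logModular_chart : (fun a => logModular (d := d) ((extChartAt (𝓡 d) (1 : S)).symm a))
    =ᶠ[𝓝 (chartOne d S)] fun a => Real.log (LinearMap.det
      (((fderiv ℝ (chartConj d S) (a, chartOne d S)).comp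
      (ContinuousLinearMap.inr ℝ E E) : E →L[ℝ] E) : E →ₗ[ℝ] E)) := by
  filter_upwards [Ad_chart_symm (d := d) (S := S)] with a ha
  unfold logModular
  congr 2
  ext1 Y
  exact ha Y

lemma clm_chartConj_one : (fderiv ℝ (chartConj d S) (chartOne d S, chartOne d S)).comp
      (ContinuousLinearMap.inr ℝ E E) = ContinuousLinearMap.id ℝ E := by
  ext1 Y
  have h := (Ad_chart_symm (d := d) (S := S)).self_of_nhds Y
  rw [chart_symm_one, Ad_one] at h
  exact h.symm

lemma contDiffAt_clm_chartConj : ContDiffAt ℝ ∞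
    (fun a => (fderiv ℝ (chartConj d S) (a, chartOne d S)).comp
      (ContinuousLinearMap.inr ℝ E E)) (chartOne d S) := by
  have h1 : ContDiffAt ℝ ∞ (fderiv ℝ (chartConj d S)) (chartOne d S, chartOne d S) :=
    contDiffAt_chartConj.fderiv_right (by simp)
  have h2 : ContDiffAt ℝ ∞ (fun a => fderiv ℝ (chartConj d S) (a, chartOne d S))
      (chartOne d S) :=
    ContDiffAt.comp (chartOne d S) (f := fun a : E => (a, chartOne d S)) h1
      (contDiffAt_id.prodMk contDiffAt_const)
  exact h2.clm_comp contDiffAt_const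

lemma contDiffAt_logModular_chart : ContDiffAt ℝ ∞
    (fun a => logModular (d := d) ((extChartAt (𝓡 d) (1 : S)).symm a)) (chartOne d S) := by
  refine ContDiffAt.congr_of_eventuallyEq ?_ logModular_chart
  refine ContDiffAt.log ?_ ?_
  · exact contDiff_clm_det.contDiffAt.comp (chartOne d S) contDiffAt_clm_chartConj
  · rw [clm_chartConj_one]
    simp

/-- Chain rule: the derivative of `det` at the identity is the trace, and that of `Ad` is `ad`. -/
lemma hasFDerivAt_logModular_chart : ∃ L : E →L[ℝ] ℝ, HasFDerivAt
    (fun a => logModular (d := d) ((extChartAt (𝓡 d) (1 : S)).symm a)) L (chartOne d S) ∧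
    ∀ X : LieAlg d S, L X = LinearMap.trace ℝ (LieAlg d S) (LieAlgebra.ad ℝ (LieAlg d S) X) := by
  have h1 := (contDiffAt_clm_chartConj (d := d) (S := S)).differentiableAt (by simp) |>.hasFDerivAt
  have h2 : HasFDerivAt (fun T : E →L[ℝ] E => LinearMap.det (T : E →ₗ[ℝ] E)) _
    ((fderiv ℝ (chartConj d S) (chartOne d S, chartOne d S)).comp
      (ContinuousLinearMap.inr ℝ E E)) :=
    ((contDiff_clm_det (V := EuclideanSpace ℝ (Fin d))).differentiable (by simp) _).hasFDerivAt
  have h3 := (HasFDerivAt.comp (chartOne d S) (f := fun a =>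
    (fderiv ℝ (chartConj d S) (a, chartOne d S)).comp (ContinuousLinearMap.inr ℝ E E)) h2 h1).log
    (by simp [Function.comp, clm_chartConj_one])
  refine ⟨_, h3.congr_of_eventuallyEq logModular_chart, fun X => ?_⟩
  simp only [Function.comp, clm_chartConj_one, ContinuousLinearMap.coe_id, LinearMap.det_id,
    inv_one, one_smul]
  refine (fderiv_clm_det_id (V := EuclideanSpace ℝ (Fin d)) _).trans (congrArg (LinearMap.trace ℝ E) ?_)
  ext1 Y
  exact fderiv_Ad_chart X Y

lemma contMDiff_logModular : ContMDiff (𝓡 d) 𝓘(ℝ, ℝ) ∞ (logModular (d := d) (S := S)) := by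
  have h1 : ContMDiffAt (𝓡 d) 𝓘(ℝ, ℝ) ∞ (logModular (d := d) (S := S)) 1 := by
    rw [contMDiffAt_iff_source, ModelWithCorners.range_eq_univ, contMDiffWithinAt_univ]
    exact contDiffAt_logModular_chart.contMDiffAt
  intro x
  -- Additivity carries smoothness from the identity to every point by translation.
  have h2 : logModular (d := d) (S := S) =
      fun y => logModular (d := d) x + logModular (d := d) (x⁻¹ * y) := by
    funext y
    rw [← logModular_mul, mul_inv_cancel_left]
  rw [h2]
  refine contMDiffAt_const.add (ContMDiffAt.comp x (f := fun y => x⁻¹ * y)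
    (g := logModular (d := d)) ?_
    (contMDiff_mul_left (I := 𝓡 d) (n := ∞)).contMDiffAt)
  rw [inv_mul_cancel]
  exact h1

lemma mfderiv_logModular (X : LieAlg d S) :
    (mfderiv (𝓡 d) 𝓘(ℝ, ℝ) (logModular (d := d) (S := S)) 1 X : ℝ) =
      LinearMap.trace ℝ (LieAlg d S) (LieAlgebra.ad ℝ (LieAlg d S) X) := by
  obtain ⟨L, hL, hX⟩ := hasFDerivAt_logModular_chart (d := d) (S := S)
  have h : HasMFDerivAt (𝓡 d) 𝓘(ℝ, ℝ) (logModular (d := d) (S := S)) 1 L := by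
    refine ⟨contMDiff_logModular.continuous.continuousAt, ?_⟩
    rw [ModelWithCorners.range_eq_univ]
    exact HasFDerivAt.hasFDerivWithinAt hL
  rw [h.mfderiv]
  exact hX X

/-- Every power of the modular function is a smooth homomorphism to the positive reals. -/
lemma exists_hom_mfderiv_eq_trace (c : ℝ) : ∃ t : S → ℝ, (∀ x, 0 < t x) ∧
    (∀ x y, t (x * y) = t x * t y) ∧ ContMDiff (𝓡 d) 𝓘(ℝ, ℝ) ∞ t ∧
    ∀ X : LieAlg d S, (mfderiv (𝓡 d) 𝓘(ℝ, ℝ) t (1 : S) X : ℝ) =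
      c * LinearMap.trace ℝ (LieAlg d S) (LieAlgebra.ad ℝ (LieAlg d S) X) := by
  have hsm : ContDiff ℝ ∞ (fun s : ℝ => Real.exp (c * s)) := (contDiff_const.mul contDiff_id).exp
  refine ⟨fun x => Real.exp (c * logModular (d := d) x), fun x => Real.exp_pos _, fun x y => ?_,
    ContMDiff.comp (I' := 𝓘(ℝ, ℝ)) (g := fun s : ℝ => Real.exp (c * s)) hsm.contMDiff contMDiff_logModular, fun X => ?_⟩
  · simp only [logModular_mul, mul_add, Real.exp_add]
  · have h1 : logModular (d := d) (1 : S) = 0 := by simp [logModular, det_Ad_one]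
    have h2 : HasFDerivAt (fun s : ℝ => Real.exp (c * s))
        (ContinuousLinearMap.toSpanSingleton ℝ c) (logModular (d := d) (1 : S)) := by
      rw [h1]
      have := ((hasDerivAt_id (0 : ℝ)).const_mul c).exp
      simpa using this.hasFDerivAt
    have h3 := HasMFDerivAt.comp (1 : S) (g := fun s : ℝ => Real.exp (c * s)) h2.hasMFDerivAt
      ((contMDiff_logModular (d := d) (S := S)).mdifferentiableAt (by simp)).hasMFDerivAt
    rw [← mfderiv_logModular]
    refine (congrArg (fun T => (T X : ℝ)) h3.mfderiv).trans ?_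
    exact mul_comm _ c

end ModularFunction

/-! ### Spectral decomposition and trace of a symmetric operator -/

section Symmetric

variable {V : Type*} [AddCommGroup V] [Module ℝ V] [FiniteDimensional ℝ V]

lemma isInternal_eigenspace_of_symmetric (c : InnerProductSpace.Core ℝ V) (T : Module.End ℝ V)
    (hT : ∀ x y, c.inner (T x) y = c.inner x (T y)) :
    DirectSum.IsInternal fun μ : Module.End.Eigenvalues T => T.eigenspace (μ : ℝ) := by
  classical
  let _ : NormedAddCommGroup V := c.toNormedAddCommGroup
  let _ : InnerProductSpace ℝ V := InnerProductSpace.ofCore c.toCore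
  have h : LinearMap.IsSymmetric T := fun x y => hT x y
  exact h.direct_sum_isInternal

lemma trace_eq_sum_finrank_eigenspace (T : Module.End ℝ V) [Fintype (Module.End.Eigenvalues T)]
    (h : DirectSum.IsInternal fun μ : Module.End.Eigenvalues T => T.eigenspace (μ : ℝ)) :
    LinearMap.trace ℝ V T = ∑ μ : Module.End.Eigenvalues T,
      (Module.finrank ℝ (T.eigenspace (μ : ℝ)) : ℝ) * (μ : ℝ) := by
  classical
  have hm : ∀ μ : Module.End.Eigenvalues T,
      Set.MapsTo T (T.eigenspace (μ : ℝ)) (T.eigenspace (μ : ℝ)) := fun μ x hx => by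
    rw [SetLike.mem_coe, Module.End.mem_eigenspace_iff] at hx ⊢
    rw [hx, map_smul, hx]
  rw [LinearMap.trace_eq_sum_trace_restrict h hm]
  refine Finset.sum_congr rfl fun μ _ => ?_
  have : T.restrict (hm μ) = (μ : ℝ) • LinearMap.id := by
    ext x
    exact Module.End.mem_eigenspace_iff.1 x.2
  rw [this, map_smul, LinearMap.trace_id, smul_eq_mul, mul_comm]

end Symmetric

/-! ### Traces of `ad` and the vector `∑ ∇_{Eₐ}Eₐ` -/

section LieAlgebra

variable {d : ℕ} {S : Type*} [TopologicalSpace S] [ChartedSpace (EuclideanSpace ℝ (Fin d)) S]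
  [Group S] [LieGroup (𝓡 d) ∞ S]

lemma ip_symm (g : Metric d S) (X Y : LieAlg d S) : ip g X Y = ip g Y X := g.symm 1 X Y

lemma ip_add_left (g : Metric d S) (X Y Z : LieAlg d S) :
    ip g (X + Y) Z = ip g X Z + ip g Y Z := by simp [ip]

lemma ip_smul_left (g : Metric d S) (c : ℝ) (X Z : LieAlg d S) :
    ip g (c • X) Z = c * ip g X Z := by simp [ip]

lemma ip_pos (g : Metric d S) {X : LieAlg d S} (hX : X ≠ 0) : 0 < ip g X X := g.pos 1 X hX

lemma ip_sum_left (g : Metric d S) {ι : Type*} (s : Finset ι) (f : ι → LieAlg d S)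
    (Z : LieAlg d S) : ip g (∑ i ∈ s, f i) Z = ∑ i ∈ s, ip g (f i) Z := by simp [ip]

/-- The metric at the neutral element as an inner product. -/
abbrev ipCore (g : Metric d S) : InnerProductSpace.Core ℝ (LieAlg d S) :=
  g.toRiemannianMetric.toCore (1 : S)

lemma ip_onb (g : Metric d S) (a b) : ip g (onb g a) (onb g b) = if a = b then 1 else 0 :=
  (exists_orthonormal_basis g).choose_spec a b

lemma onb_repr (g : Metric d S) (X : LieAlg d S) (a) : (onb g).repr X a = ip g X (onb g a) := by
  conv_rhs => rw [← (onb g).sum_repr X]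
  rw [ip_sum_left]
  simp only [ip_smul_left, ip_onb]
  simp

lemma sum_ip_smul_onb (g : Metric d S) (X : LieAlg d S) :
    ∑ a, ip g X (onb g a) • onb g a = X := by
  conv_rhs => rw [← (onb g).sum_repr X]
  simp only [onb_repr]

lemma trace_eq_sum_ip (g : Metric d S) (T : Module.End ℝ (LieAlg d S)) :
    LinearMap.trace ℝ (LieAlg d S) T = ∑ a, ip g (T (onb g a)) (onb g a) := by
  rw [LinearMap.trace_eq_matrix_trace ℝ (onb g), Matrix.trace]
  refine Finset.sum_congr rfl fun a _ => ?_
  rw [Matrix.diag_apply, LinearMap.toMatrix_apply, onb_repr]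

/-- The trace of `ad X`. -/
def trAd (X : LieAlg d S) : ℝ :=
  LinearMap.trace ℝ (LieAlg d S) (LieAlgebra.ad ℝ (LieAlg d S) X)

lemma trAd_add (X Y : LieAlg d S) : trAd (X + Y) = trAd X + trAd Y := by simp [trAd]

lemma trAd_smul (c : ℝ) (X : LieAlg d S) : trAd (c • X) = c * trAd X := by simp [trAd]

/-- `ad` of a bracket is a commutator, and commutators have trace zero. -/
lemma trAd_eq_zero_of_mem_nil {X : LieAlg d S} (hX : X ∈ nil d S) : trAd X = 0 := by
  rw [← LieSubmodule.mem_toSubmodule, LieSubmodule.lieIdeal_oper_eq_linear_span'] at hX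
  induction hX using Submodule.span_induction with
  | mem x hx =>
    obtain ⟨y, -, z, -, rfl⟩ := hx
    have h : LieAlgebra.ad ℝ (LieAlg d S) ⁅y, z⁆ =
        LieAlgebra.ad ℝ (LieAlg d S) y * LieAlgebra.ad ℝ (LieAlg d S) z -
          LieAlgebra.ad ℝ (LieAlg d S) z * LieAlgebra.ad ℝ (LieAlg d S) y := by
      ext1 w
      exact lie_lie y z w
    rw [trAd, h, map_sub, LinearMap.trace_mul_comm, sub_self]
  | zero => simp [trAd]
  | add x y _ _ hx hy => rw [trAd_add, hx, hy, add_zero]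
  | smul c x _ hx => rw [trAd_smul, hx, mul_zero]

/-- On the diagonal the Koszul formula reduces to `⟨∇_{Eₐ}Eₐ, E_b⟩ = ⟨[E_b, Eₐ], Eₐ⟩`, whose sum
over `a` is the trace of `ad E_b`. -/
lemma sum_leviCivita_onb (g : Metric d S) :
    ∑ a, leviCivita g (onb g a) (onb g a) = ∑ b, trAd (onb g b) • onb g b := by
  simp only [leviCivita]
  rw [Finset.sum_comm]
  refine Finset.sum_congr rfl fun b _ => ?_
  rw [← Finset.sum_smul, trAd, trace_eq_sum_ip g]
  congr 1
  refine Finset.sum_congr rfl fun a _ => ?_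
  rw [lie_self, LieAlgebra.ad_apply, ← lie_skew (onb g a) (onb g b)]
  simp only [ip, map_neg, neg_apply, map_zero,
    zero_apply]
  ring

lemma exists_add_mem_nil_mem_aSub (g : Metric d S) (X : LieAlg d S) :
    ∃ Y ∈ nil d S, ∃ Z ∈ aSub g, Y + Z = X := by
  let c := ipCore g
  let _ : NormedAddCommGroup (LieAlg d S) := c.toNormedAddCommGroup
  let _ : InnerProductSpace ℝ (LieAlg d S) := InnerProductSpace.ofCore c.toCore
  obtain ⟨y, hy, z, hz, h⟩ :=
    (LieSubmodule.toSubmodule (nil d S)).exists_add_mem_mem_orthogonal X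
  refine ⟨y, hy, z, fun Y hY => ?_, h.symm⟩
  rw [ip_symm]
  exact (Submodule.mem_orthogonal _ z).1 hz Y hY

section RankOne

variable {g : Metric d S} {A : LieAlg d S}

lemma exists_add_smul_eq (hrank : rank g = 1) (hA : IsUnitPositive g A) (X : LieAlg d S) :
    ∃ Y ∈ nil d S, Y + ip g X A • A = X := by
  obtain ⟨Y, hY, Z, hZ, rfl⟩ := exists_add_mem_nil_mem_aSub g X
  have hA0 : (⟨A, hA.mem⟩ : aSub g) ≠ 0 := by
    intro h
    have h1 : A = 0 := congrArg Subtype.val h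
    have h2 := hA.unit
    rw [h1] at h2
    simp [ip] at h2
  obtain ⟨c, hc⟩ := exists_smul_eq_of_finrank_eq_one hrank hA0 ⟨Z, hZ⟩
  have hc' : c • A = Z := congrArg Subtype.val hc
  refine ⟨Y, hY, ?_⟩
  rw [ip_add_left, ip_symm g Y A, hA.mem Y hY, ← hc', ip_smul_left, hA.unit]
  simp

lemma trAd_eq (hrank : rank g = 1) (hA : IsUnitPositive g A) (X : LieAlg d S) :
    trAd X = ip g X A * trAd A := by
  obtain ⟨Y, hY, hX⟩ := exists_add_smul_eq hrank hA X
  conv_lhs => rw [← hX]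
  rw [trAd_add, trAd_smul, trAd_eq_zero_of_mem_nil hY, zero_add]

/-- The image of `ad A` lies in `𝔫 = [𝔰, 𝔰]`, so the complement contributes nothing to the trace. -/
lemma trAd_eq_trace_adN (A : LieAlg d S) : trAd A = LinearMap.trace ℝ (nil d S) (adN A) := by
  have h : ∀ X, LieAlgebra.ad ℝ (LieAlg d S) A X ∈ LieSubmodule.toSubmodule (nil d S) := fun X =>
    LieSubmodule.lie_mem_lie (LieSubmodule.mem_top A) (LieSubmodule.mem_top X)
  exact (LinearMap.trace_restrict_eq_of_forall_mem _ _ h).symm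

lemma isInternal_eigenspace_adN
    (hsymm : ∀ X ∈ nil d S, ∀ Y ∈ nil d S, ip g ⁅A, X⁆ Y = ip g X ⁅A, Y⁆) :
    DirectSum.IsInternal fun μ : Eig A => (adN A).eigenspace (lam μ) := by
  let c : InnerProductSpace.Core ℝ (nil d S) :=
    { inner := fun X Y => ip g X Y
      conj_inner_symm := fun X Y => ip_symm g _ _
      re_inner_nonneg := fun X => (ipCore g).re_inner_nonneg X.1
      add_left := fun X Y Z => ip_add_left g _ _ _
      smul_left := fun X Y r => ip_smul_left g _ _ _
      definite := fun X hX => Subtype.ext ((ipCore g).definite X.1 hX) }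
  exact isInternal_eigenspace_of_symmetric c (adN A) fun X Y => hsymm X X.2 Y Y.2

lemma trAd_eq_nn (hsymm : ∀ X ∈ nil d S, ∀ Y ∈ nil d S, ip g ⁅A, X⁆ Y = ip g X ⁅A, Y⁆) :
    trAd A = nn A := by
  rw [trAd_eq_trace_adN, trace_eq_sum_finrank_eigenspace _ (isInternal_eigenspace_adN hsymm)]
  rfl

lemma lam_pos (hpos : AdPosDef g A) (k : Eig A) : 0 < lam k := by
  obtain ⟨X, hX⟩ := Module.End.HasEigenvalue.exists_hasEigenvector k.2
  have h0 : (X : LieAlg d S) ≠ 0 := fun h => hX.2 (Subtype.ext h)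
  have h1 : ⁅A, (X : LieAlg d S)⁆ = lam k • (X : LieAlg d S) :=
    congrArg Subtype.val hX.apply_eq_smul
  have h2 := hpos X X.2 h0
  rw [h1, ip_smul_left] at h2
  exact pos_of_mul_pos_left h2 (ip_pos g h0).le

/-- The eigenspaces span `𝔫`, so `𝔫 ≠ 0` provides at least one eigenvalue; all of them are positive.
-/
lemma nn_pos (hpos : AdPosDef g A) (hn : nil d S ≠ ⊥)
    (hsymm : ∀ X ∈ nil d S, ∀ Y ∈ nil d S, ip g ⁅A, X⁆ Y = ip g X ⁅A, Y⁆) : 0 < nn A := by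
  have hne : Nonempty (Eig A) := by
    by_contra hne
    rw [not_nonempty_iff] at hne
    have h := (isInternal_eigenspace_adN hsymm).submodule_iSup_eq_top
    rw [iSup_of_empty] at h
    refine hn ((LieSubmodule.eq_bot_iff _).2 fun X hX => ?_)
    have h1 : (⟨X, hX⟩ : nil d S) ∈ (⊥ : Submodule ℝ (nil d S)) := h ▸ Submodule.mem_top
    exact congrArg Subtype.val ((Submodule.mem_bot ℝ).1 h1)
  refine Finset.sum_pos (fun k _ => mul_pos ?_ (lam_pos hpos k)) Finset.univ_nonempty
  obtain ⟨X, hX⟩ := Module.End.HasEigenvalue.exists_hasEigenvector k.2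
  have : Nontrivial ((adN A).eigenspace (lam k)) :=
    ⟨⟨X, hX.1⟩, 0, fun h => hX.2 (congrArg Subtype.val h)⟩
  exact_mod_cast Module.finrank_pos

lemma sum_leviCivita_onb_eq (hrank : rank g = 1) (hA : IsUnitPositive g A) :
    ∑ a, leviCivita g (onb g a) (onb g a) = trAd A • A := by
  rw [sum_leviCivita_onb]
  refine Eq.trans ?_ (congrArg (trAd A • ·) (sum_ip_smul_onb g A))
  rw [Finset.smul_sum]
  refine Finset.sum_congr rfl fun b _ => ?_
  rw [trAd_eq hrank hA, ip_symm, smul_smul, mul_comm]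

end RankOne

end LieAlgebra

/-! ### Differentiation along left-invariant vector fields -/

section LieDerivative

variable {d : ℕ} {S : Type*} [TopologicalSpace S] [ChartedSpace (EuclideanSpace ℝ (Fin d)) S]
  [Group S] [LieGroup (𝓡 d) ∞ S]

/-- Smooth complex-valued functions. -/
abbrev IsSmooth (φ : S → ℂ) : Prop := ContMDiff (𝓡 d) 𝓘(ℝ, ℂ) ∞ φ

lemma IsSmooth.mdifferentiable {φ : S → ℂ} (h : IsSmooth (d := d) φ) :
    MDifferentiable (𝓡 d) 𝓘(ℝ, ℂ) φ :=
  ContMDiff.mdifferentiable h (by simp)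

lemma lieDeriv_add_left (X Y : LieAlg d S) (φ : S → ℂ) (x : S) :
    lieDeriv (X + Y) φ x = lieDeriv X φ x + lieDeriv Y φ x := by
  simp only [lieDeriv, mulInvariantVectorField_add]
  exact map_add _ _ _

lemma lieDeriv_smul_left (c : ℝ) (X : LieAlg d S) (φ : S → ℂ) (x : S) :
    lieDeriv (c • X) φ x = (c : ℂ) * lieDeriv X φ x := by
  simp only [lieDeriv, mulInvariantVectorField_smul]
  exact map_smul (mfderiv (𝓡 d) 𝓘(ℝ, ℂ) φ x : TangentSpace (𝓡 d) x →L[ℝ] ℂ) c _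

lemma lieDeriv_sum_left {ι : Type*} (s : Finset ι) (X : ι → LieAlg d S) (φ : S → ℂ) (x : S) :
    lieDeriv (∑ i ∈ s, X i) φ x = ∑ i ∈ s, lieDeriv (X i) φ x := by
  classical
  induction s using Finset.induction_on with
  | empty =>
    have h := lieDeriv_smul_left (0 : ℝ) (0 : LieAlg d S) φ x
    simpa using h
  | insert a s ha ih => rw [Finset.sum_insert ha, Finset.sum_insert ha, lieDeriv_add_left, ih]

lemma lieDeriv_add (X : LieAlg d S) {φ ψ : S → ℂ} {x : S}
    (hφ : MDifferentiableAt (𝓡 d) 𝓘(ℝ, ℂ) φ x) (hψ : MDifferentiableAt (𝓡 d) 𝓘(ℝ, ℂ) ψ x) :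
    lieDeriv X (fun y => φ y + ψ y) x = lieDeriv X φ x + lieDeriv X ψ x := by
  unfold lieDeriv
  refine (congrArg (fun T => (T (mulInvariantVectorField X x) : ℂ))
    (hφ.hasMFDerivAt.add hψ.hasMFDerivAt).mfderiv).trans ?_
  rfl

lemma lieDeriv_const_mul (X : LieAlg d S) (c : ℂ) {φ : S → ℂ} {x : S}
    (hφ : MDifferentiableAt (𝓡 d) 𝓘(ℝ, ℂ) φ x) :
    lieDeriv X (fun y => c * φ y) x = c * lieDeriv X φ x := by
  unfold lieDeriv
  refine (congrArg (fun T => (T (mulInvariantVectorField X x) : ℂ))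
    ((hasMFDerivAt_const c x).mul hφ.hasMFDerivAt).mfderiv).trans ?_
  refine Eq.trans (b := c * lieDeriv X φ x + φ x * 0) rfl ?_
  rw [mul_zero, add_zero]
  rfl

/-- The derivative of a real-valued function along the left-invariant vector field of `X`. -/
def lieDerivReal (X : LieAlg d S) (u : S → ℝ) (x : S) : ℝ :=
  mfderiv (𝓡 d) 𝓘(ℝ, ℝ) u x (mulInvariantVectorField X x)

lemma lieDeriv_mul_comp (X : LieAlg d S) {φ : S → ℂ} {u : S → ℝ} {F : ℝ → ℝ} {F' : ℝ} {x : S}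
    (hφ : MDifferentiableAt (𝓡 d) 𝓘(ℝ, ℂ) φ x) (hu : MDifferentiableAt (𝓡 d) 𝓘(ℝ, ℝ) u x)
    (hF : HasDerivAt F F' (u x)) :
    lieDeriv X (fun y => φ y * (F (u y) : ℂ)) x = lieDeriv X φ x * (F (u x) : ℂ) +
      (lieDerivReal X u x : ℂ) * (φ x * (F' : ℂ)) := by
  have h1 : HasMFDerivAt 𝓘(ℝ, ℝ) 𝓘(ℝ, ℂ) (fun s => (F s : ℂ)) (u x)
      (ContinuousLinearMap.toSpanSingleton ℝ (F' : ℂ)) :=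
    hF.ofReal_comp.hasFDerivAt.hasMFDerivAt
  have h2 := HasMFDerivAt.comp x h1 hu.hasMFDerivAt
  have h3 := hφ.hasMFDerivAt.mul h2
  unfold lieDeriv
  refine (congrArg (fun T => (T (mulInvariantVectorField X x) : ℂ)) h3.mfderiv).trans ?_
  have h4 : ∀ s : ℝ, ContinuousLinearMap.toSpanSingleton ℝ (F' : ℂ) s = (s : ℂ) * F' := fun s => by
    simp
  refine Eq.trans (b := φ x * (ContinuousLinearMap.toSpanSingleton ℝ (F' : ℂ)
    (lieDerivReal X u x)) + (F (u x) : ℂ) * lieDeriv X φ x) rfl ?_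
  rw [h4]
  change _ = lieDeriv X φ x * (F (u x) : ℂ) + _
  ring

-- The value of the field at `x` is the tangent map of multiplication applied to the zero vector at
-- `x` and to `X` at the identity, which depends smoothly on `x`.
open Bundle in
lemma contMDiff_infty_mulInvariantVectorField (X : LieAlg d S) :
    ContMDiff (𝓡 d) (𝓡 d).tangent ∞
      (fun x : S => (mulInvariantVectorField X x : TangentBundle (𝓡 d) S)) := by
  let fg : S → TangentBundle (𝓡 d) S := fun x => TotalSpace.mk' (EuclideanSpace ℝ (Fin d)) x 0
  have sfg : ContMDiff (𝓡 d) (𝓡 d).tangent ∞ fg := contMDiff_zeroSection _ _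
  let fv : S → TangentBundle (𝓡 d) S := fun _ => TotalSpace.mk' (EuclideanSpace ℝ (Fin d)) 1 X
  have sfv : ContMDiff (𝓡 d) (𝓡 d).tangent ∞ fv := contMDiff_const
  let F₁ : S → TangentBundle (𝓡 d) S × TangentBundle (𝓡 d) S := fun x => (fg x, fv x)
  have S₁ : ContMDiff (𝓡 d) ((𝓡 d).tangent.prod (𝓡 d).tangent) ∞ F₁ := sfg.prodMk sfv
  let F₂ : TangentBundle (𝓡 d) S × TangentBundle (𝓡 d) S →
      TangentBundle ((𝓡 d).prod (𝓡 d)) (S × S) := (equivTangentBundleProd (𝓡 d) S (𝓡 d) S).symm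
  have S₂ : ContMDiff ((𝓡 d).tangent.prod (𝓡 d).tangent) ((𝓡 d).prod (𝓡 d)).tangent ∞ F₂ :=
    contMDiff_equivTangentBundleProd_symm
  let F₃ : TangentBundle ((𝓡 d).prod (𝓡 d)) (S × S) → TangentBundle (𝓡 d) S :=
    tangentMap ((𝓡 d).prod (𝓡 d)) (𝓡 d) (fun p : S × S => p.1 * p.2)
  have S₃ : ContMDiff ((𝓡 d).prod (𝓡 d)).tangent (𝓡 d).tangent ∞ F₃ :=
    (contMDiff_mul (𝓡 d) ∞).contMDiff_tangentMap (m := ∞) (by simp)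
  refine ((S₃.comp S₂).comp S₁).congr fun x => ?_
  -- The tangent map lands over `x * 1`. The base points are matched first, so that only vectors of
  -- the model space remain to be compared.
  have key : ∀ w : EuclideanSpace ℝ (Fin d), w = mulInvariantVectorField X x →
      (mulInvariantVectorField X x : TangentBundle (𝓡 d) S) = ⟨x * 1, w⟩ := by
    rintro _ rfl
    exact TotalSpace.ext (mul_one x).symm HEq.rfl
  refine key _ ?_
  have h := mfderiv_prod_eq_add_apply (I := 𝓡 d) (I' := 𝓡 d) (I'' := 𝓡 d)
    (f := fun p : S × S => p.1 * p.2) (p := (x, 1)) (v := ((0 : EuclideanSpace ℝ (Fin d)), X))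
    ((contMDiff_mul (𝓡 d) ∞).mdifferentiable (by simp) _)
  refine h.trans ?_
  have h0 : ∀ (L : EuclideanSpace ℝ (Fin d) →L[ℝ] EuclideanSpace ℝ (Fin d))
      (w : EuclideanSpace ℝ (Fin d)), L 0 + w = w := by simp
  exact h0 _ _

lemma IsSmooth.lieDeriv (X : LieAlg d S) {φ : S → ℂ} (hφ : IsSmooth (d := d) φ) :
    IsSmooth (d := d) (lieDeriv X φ) :=
  (contMDiff_snd_tangentBundle_modelSpace ℂ 𝓘(ℝ, ℂ)).comp
    ((ContMDiff.contMDiff_tangentMap hφ (m := ∞) (by simp)).comp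
      (contMDiff_infty_mulInvariantVectorField X))

end LieDerivative

/-! ### The operator `τ` on products with functions of `log t` -/

section Tension

variable {d : ℕ} {S : Type*} [TopologicalSpace S] [ChartedSpace (EuclideanSpace ℝ (Fin d)) S]
  [Group S] [LieGroup (𝓡 d) ∞ S]

lemma IsSmooth.add {φ ψ : S → ℂ} (hφ : IsSmooth (d := d) φ) (hψ : IsSmooth (d := d) ψ) :
    IsSmooth (d := d) fun x => φ x + ψ x := ContMDiff.add hφ hψ

lemma IsSmooth.mul {φ ψ : S → ℂ} (hφ : IsSmooth (d := d) φ) (hψ : IsSmooth (d := d) ψ) :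
    IsSmooth (d := d) fun x => φ x * ψ x :=
  (contDiff_mul (𝕜 := ℝ) (𝔸 := ℂ)).contMDiff.comp (hφ.prodMk_space hψ)

lemma IsSmooth.const_mul (c : ℂ) {φ : S → ℂ} (hφ : IsSmooth (d := d) φ) :
    IsSmooth (d := d) fun x => c * φ x := IsSmooth.mul contMDiff_const hφ

lemma isSmooth_zero : IsSmooth (d := d) (fun _ : S => (0 : ℂ)) := contMDiff_const

lemma IsSmooth.sum {ι : Type*} (s : Finset ι) {φ : ι → S → ℂ}
    (hφ : ∀ i ∈ s, IsSmooth (d := d) (φ i)) : IsSmooth (d := d) fun x => ∑ i ∈ s, φ i x := by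
  classical
  induction s using Finset.induction_on with
  | empty => simpa using isSmooth_zero
  | insert a s ha ih =>
    simp only [Finset.sum_insert ha]
    exact (hφ a (Finset.mem_insert_self a s)).add
      (ih fun i hi => hφ i (Finset.mem_insert_of_mem hi))

lemma IsSmooth.mul_comp {φ : S → ℂ} {u : S → ℝ} {F : ℝ → ℝ} (hφ : IsSmooth (d := d) φ)
    (hu : ContMDiff (𝓡 d) 𝓘(ℝ, ℝ) ∞ u) (hF : ContDiff ℝ ∞ F) :
    IsSmooth (d := d) fun x => φ x * (F (u x) : ℂ) := by
  have h1 : ContDiff ℝ ∞ (fun s => (F s : ℂ)) := Complex.ofRealCLM.contDiff.comp hF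
  exact hφ.mul (h1.contMDiff.comp hu)

lemma tau_add (g : Metric d S) {φ ψ : S → ℂ} (hφ : IsSmooth (d := d) φ)
    (hψ : IsSmooth (d := d) ψ) (x : S) :
    tau g (fun y => φ y + ψ y) x = tau g φ x + tau g ψ x := by
  simp only [tau, ← Finset.sum_add_distrib]
  refine Finset.sum_congr rfl fun a _ => ?_
  have h : lieDeriv (onb g a) (fun y => φ y + ψ y) =
      fun y => lieDeriv (onb g a) φ y + lieDeriv (onb g a) ψ y :=
    funext fun y => lieDeriv_add _ (hφ.mdifferentiable y) (hψ.mdifferentiable y)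
  rw [h, lieDeriv_add _ ((hφ.lieDeriv _).mdifferentiable x) ((hψ.lieDeriv _).mdifferentiable x),
    lieDeriv_add _ (hφ.mdifferentiable x) (hψ.mdifferentiable x)]
  ring

lemma tau_const_mul (g : Metric d S) (c : ℂ) {φ : S → ℂ} (hφ : IsSmooth (d := d) φ) (x : S) :
    tau g (fun y => c * φ y) x = c * tau g φ x := by
  simp only [tau, Finset.mul_sum]
  refine Finset.sum_congr rfl fun a _ => ?_
  have h : lieDeriv (onb g a) (fun y => c * φ y) = fun y => c * lieDeriv (onb g a) φ y :=
    funext fun y => lieDeriv_const_mul _ c (hφ.mdifferentiable y)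
  rw [h, lieDeriv_const_mul _ c ((hφ.lieDeriv _).mdifferentiable x),
    lieDeriv_const_mul _ c (hφ.mdifferentiable x)]
  ring

lemma tau_zero (g : Metric d S) (x : S) : tau g (fun _ => 0) x = 0 := by
  simpa using tau_const_mul g 0 (isSmooth_zero (d := d)) x

lemma tau_sum (g : Metric d S) {ι : Type*} (s : Finset ι) {φ : ι → S → ℂ}
    (hφ : ∀ i ∈ s, IsSmooth (d := d) (φ i)) (x : S) :
    tau g (fun y => ∑ i ∈ s, φ i y) x = ∑ i ∈ s, tau g (φ i) x := by
  classical
  induction s using Finset.induction_on with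
  | empty => simpa using tau_zero g x
  | insert a s ha ih =>
    have hs : ∀ i ∈ s, IsSmooth (d := d) (φ i) := fun i hi => hφ i (Finset.mem_insert_of_mem hi)
    simp only [Finset.sum_insert ha]
    rw [tau_add g (hφ a (Finset.mem_insert_self a s)) (IsSmooth.sum s hs), ih hs]

/-- `u` is the additive coordinate `log t`: a smooth function whose derivative along the
left-invariant vector field of `X` is the component of `X` along `A`. -/
structure IsLogCoordinate (g : Metric d S) (A : LieAlg d S) (u : S → ℝ) : Prop where
  smooth : ContMDiff (𝓡 d) 𝓘(ℝ, ℝ) ∞ u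
  deriv : ∀ (X : LieAlg d S) (x : S), lieDerivReal X u x = ip g X A

variable {g : Metric d S} {A : LieAlg d S} {u : S → ℝ}

lemma IsLogCoordinate.mdifferentiable (hu : IsLogCoordinate g A u) :
    MDifferentiable (𝓡 d) 𝓘(ℝ, ℝ) u := hu.smooth.mdifferentiable (by simp)

/-- `log t` is a homomorphism to `ℝ`, so its derivative along a left-invariant field is constant. At
the identity it is read off from `𝔰 = 𝔫 ⊕ ℝA`. -/
lemma IsTCoordinate.isLogCoordinate {t : S → ℝ} (ht : IsTCoordinate A t) (hrank : rank g = 1)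
    (hA : IsUnitPositive g A) : IsLogCoordinate g A (fun x => Real.log (t x)) := by
  have hsm : ContMDiff (𝓡 d) 𝓘(ℝ, ℝ) ∞ (fun x => Real.log (t x)) := fun x =>
    ContMDiffAt.comp x (g := Real.log)
      (Real.contDiffAt_log.2 (ht.pos x).ne').contMDiffAt ht.smooth.contMDiffAt
  have ht1 : t 1 = 1 := by
    have h := ht.map_mul 1 1
    rw [mul_one] at h
    exact (mul_eq_left₀ (ht.pos 1).ne').1 h.symm
  refine ⟨hsm, fun X x => ?_⟩
  have hd1 : HasMFDerivAt (𝓡 d) 𝓘(ℝ, ℝ) (fun x => Real.log (t x)) 1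
      ((ContinuousLinearMap.toSpanSingleton ℝ (t 1)⁻¹).comp (mfderiv (𝓡 d) 𝓘(ℝ, ℝ) t 1)) :=
    HasMFDerivAt.comp (1 : S) (g := Real.log)
      (Real.hasDerivAt_log (ht.pos 1).ne').hasFDerivAt.hasMFDerivAt
      (ht.smooth.mdifferentiableAt (by simp)).hasMFDerivAt
  -- left invariance
  have h1 : HasMFDerivAt (𝓡 d) 𝓘(ℝ, ℝ) (fun x => Real.log (t x)) (x * 1)
      (mfderiv (𝓡 d) 𝓘(ℝ, ℝ) (fun x => Real.log (t x)) x) := by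
    rw [mul_one]
    exact (hsm.mdifferentiableAt (by simp)).hasMFDerivAt
  have h2 : HasMFDerivAt (𝓡 d) (𝓡 d) (fun y : S => x * y) 1
      (mfderiv (𝓡 d) (𝓡 d) (fun y : S => x * y) 1) :=
    ((contMDiff_mul_left (I := 𝓡 d) (n := ∞)).mdifferentiableAt (by simp)).hasMFDerivAt
  have h3 := HasMFDerivAt.comp (1 : S) (f := fun y : S => x * y) h1 h2
  have h4 : (fun x => Real.log (t x)) ∘ (fun y : S => x * y) =
      (fun _ => Real.log (t x)) + fun y => Real.log (t y) := by
    funext y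
    simp [ht.map_mul, Real.log_mul (ht.pos x).ne' (ht.pos y).ne']
  rw [h4] at h3
  have h5 := (hasMFDerivAt_const (I := 𝓡 d) (I' := 𝓘(ℝ, ℝ)) (Real.log (t x)) (1 : S)).add hd1
  have h6 := congrArg (fun T => (T X : ℝ)) (hasMFDerivAt_unique h3 h5)
  obtain ⟨Y, hY, hX⟩ := exists_add_smul_eq hrank hA X
  have h7 : ∀ L : LieAlg d S →L[ℝ] ℝ, L A = 1 → L Y = 0 → L X = ip g X A := by
    intro L hLA hLY
    have h := congrArg L hX
    rw [map_add, map_smul, hLA, hLY, zero_add, smul_eq_mul, mul_one] at h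
    exact h.symm
  have h8 : ∀ D : ℝ, D = ip g X A →
      (0 : ℝ) + ContinuousLinearMap.toSpanSingleton ℝ (t 1)⁻¹ D = ip g X A := by
    rintro _ rfl
    simp [ht1]
  exact h6.trans (h8 _ (h7 (mfderiv (𝓡 d) 𝓘(ℝ, ℝ) t 1) ht.deriv_A (ht.deriv_nil Y hY)))

lemma IsLogCoordinate.lieDeriv_mul_comp (hu : IsLogCoordinate g A u) (X : LieAlg d S)
    {φ : S → ℂ} {F F' : ℝ → ℝ} {x : S} (hφ : MDifferentiableAt (𝓡 d) 𝓘(ℝ, ℂ) φ x)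
    (hF : ∀ s, HasDerivAt F (F' s) s) :
    lieDeriv X (fun y => φ y * (F (u y) : ℂ)) x = lieDeriv X φ x * (F (u x) : ℂ) +
      (ip g X A : ℂ) * (φ x * (F' (u x) : ℂ)) := by
  rw [IwasawaRankOne.lieDeriv_mul_comp X hφ (hu.mdifferentiable x) (hF (u x)), hu.deriv]

lemma IsLogCoordinate.mdifferentiableAt_mul_comp (hu : IsLogCoordinate g A u)
    {φ : S → ℂ} {F F' : ℝ → ℝ} {x : S} (hφ : MDifferentiableAt (𝓡 d) 𝓘(ℝ, ℂ) φ x)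
    (hF : ∀ s, HasDerivAt F (F' s) s) :
    MDifferentiableAt (𝓡 d) 𝓘(ℝ, ℂ) (fun y => φ y * (F (u y) : ℂ)) x :=
  (hφ.hasMFDerivAt.mul (HasMFDerivAt.comp x (g := fun s => (F s : ℂ))
    (hF (u x)).ofReal_comp.hasFDerivAt.hasMFDerivAt
    (hu.mdifferentiable x).hasMFDerivAt)).mdifferentiableAt

/-- The tension field of the product of a function independent of `t` and a function of `t`. -/
lemma IsLogCoordinate.tau_mul_comp (hu : IsLogCoordinate g A u) (hrank : rank g = 1)
    (hA : IsUnitPositive g A) {φ : S → ℂ} {F F' F'' : ℝ → ℝ} (hφ : IsSmooth (d := d) φ)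
    (hAφ : IndepOfT A φ) (hF : ∀ s, HasDerivAt F (F' s) s) (hF' : ∀ s, HasDerivAt F' (F'' s) s)
    (x : S) :
    tau g (fun y => φ y * (F (u y) : ℂ)) x = tau g φ x * (F (u x) : ℂ) +
      φ x * ((F'' (u x) - trAd A * F' (u x) : ℝ) : ℂ) := by
  have tau_eq : ∀ ψ : S → ℂ, tau g ψ x =
      ∑ a, lieDeriv (onb g a) (lieDeriv (onb g a) ψ) x - (trAd A : ℂ) * lieDeriv A ψ x := by
    intro ψ
    rw [tau, Finset.sum_sub_distrib, ← lieDeriv_sum_left, sum_leviCivita_onb_eq hrank hA,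
      lieDeriv_smul_left]
  have h1 : ∀ X : LieAlg d S, lieDeriv X (lieDeriv X fun y => φ y * (F (u y) : ℂ)) x =
      lieDeriv X (lieDeriv X φ) x * (F (u x) : ℂ) +
      2 * ((ip g X A : ℂ) * lieDeriv X φ x) * (F' (u x) : ℂ) +
      (ip g X A : ℂ) * (ip g X A : ℂ) * (φ x * (F'' (u x) : ℂ)) := by
    intro X
    have h2 : lieDeriv X (fun y => φ y * (F (u y) : ℂ)) = fun y =>
        lieDeriv X φ y * (F (u y) : ℂ) + (ip g X A : ℂ) * (φ y * (F' (u y) : ℂ)) :=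
      funext fun y => hu.lieDeriv_mul_comp X (hφ.mdifferentiable y) hF
    have d1 := (hφ.lieDeriv X).mdifferentiable x
    have d2 := hu.mdifferentiableAt_mul_comp (hφ.mdifferentiable x) hF'
    have d3 : MDifferentiableAt (𝓡 d) 𝓘(ℝ, ℂ)
        (fun y => (ip g X A : ℂ) * (φ y * (F' (u y) : ℂ))) x := mdifferentiableAt_const.mul d2
    rw [h2, lieDeriv_add X (hu.mdifferentiableAt_mul_comp d1 hF) d3, lieDeriv_const_mul X _ d2,
      hu.lieDeriv_mul_comp X d1 hF, hu.lieDeriv_mul_comp X (hφ.mdifferentiable x) hF']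
    ring
  -- The mixed first-order terms add up to the derivative of `φ` along `∑ ⟨Eₐ, A⟩Eₐ = A`.
  have h3 : ∑ a, (ip g (onb g a) A : ℂ) * lieDeriv (onb g a) φ x = 0 := by
    simp only [← lieDeriv_smul_left, ← lieDeriv_sum_left, ip_symm g _ A]
    rw [sum_ip_smul_onb]
    exact hAφ x
  have h4 : ∑ a, (ip g (onb g a) A : ℂ) * (ip g (onb g a) A : ℂ) = 1 := by
    have h5 : ∑ a, ip g (onb g a) A * ip g (onb g a) A = 1 := by
      have h6 := congrArg (fun X => ip g X A) (sum_ip_smul_onb g A)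
      simp only [ip_sum_left, ip_smul_left, hA.unit, ip_symm g A (onb g _)] at h6
      exact h6
    exact_mod_cast congrArg (fun s : ℝ => (s : ℂ)) h5
  rw [tau_eq, tau_eq]
  simp only [h1]
  rw [Finset.sum_add_distrib, Finset.sum_add_distrib, ← Finset.sum_mul, ← Finset.sum_mul,
    ← Finset.sum_mul, ← Finset.mul_sum, h3, h4,
    hu.lieDeriv_mul_comp A (hφ.mdifferentiable x) hF, hA.unit, hAφ x]
  push_cast
  ring

/-- Functions `H i * exp (μ i * u)` with different exponents and `H i` independent of `t` are
linearly independent. -/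
lemma IsLogCoordinate.eq_zero_of_sum_exp (hu : IsLogCoordinate g A u) (hA : IsUnitPositive g A)
    {ι : Type*} (s : Finset ι) (μ : ι → ℝ) (μ₀ : ℝ) (hμ : ∀ i ∈ s, μ i ≠ μ₀)
    (H : ι → S → ℂ) (H₀ : S → ℂ) (hH : ∀ i, IsSmooth (d := d) (H i))
    (hAH : ∀ i, IndepOfT A (H i)) (hH₀ : IsSmooth (d := d) H₀) (hAH₀ : IndepOfT A H₀)
    (h : ∀ x, H₀ x * (Real.exp (μ₀ * u x) : ℂ) +
      ∑ i ∈ s, H i x * (Real.exp (μ i * u x) : ℂ) = 0) : H₀ = 0 := by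
  classical
  have hexp : ∀ c s : ℝ, HasDerivAt (fun s => Real.exp (c * s)) (c * Real.exp (c * s)) s := by
    intro c s
    simpa [mul_comm] using ((hasDerivAt_id s).const_mul c).exp
  have hmono : ∀ (φ : S → ℂ) (c : ℝ), IsSmooth (d := d) φ → IndepOfT A φ → ∀ x,
      lieDeriv A (fun y => φ y * (Real.exp (c * u y) : ℂ)) x =
        c * φ x * (Real.exp (c * u x) : ℂ) := by
    intro φ c hφ hAφ x
    rw [hu.lieDeriv_mul_comp A (F := fun s => Real.exp (c * s)) (hφ.mdifferentiable x) (hexp c),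
      hAφ x, hA.unit]
    push_cast
    ring
  have hindep : ∀ (φ : S → ℂ) (c : ℂ), IsSmooth (d := d) φ → IndepOfT A φ →
      IndepOfT A fun x => c * φ x := by
    intro φ c hφ hAφ x
    rw [lieDeriv_const_mul A c (hφ.mdifferentiable x), hAφ x, mul_zero]
  have hsmooth : ∀ (φ : S → ℂ) (c : ℝ), IsSmooth (d := d) φ →
      IsSmooth (d := d) fun y => φ y * (Real.exp (c * u y) : ℂ) := fun φ c hφ =>
    hφ.mul_comp (F := fun s => Real.exp (c * s)) hu.smooth (contDiff_const.mul contDiff_id).exp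
  induction s using Finset.induction_on generalizing H H₀ with
  | empty =>
    funext x
    have := h x
    rw [Finset.sum_empty, add_zero, mul_eq_zero, Complex.ofReal_eq_zero] at this
    exact this.resolve_right (Real.exp_pos _).ne'
  | insert j s hj ih =>
    have hshift : ∀ (a b : ℝ) (x : S), (Real.exp (a * u x) : ℂ) * (Real.exp (-b * u x) : ℂ) =
        (Real.exp ((a - b) * u x) : ℂ) := by
      intro a b x
      rw [← Complex.ofReal_mul, ← Real.exp_add]
      congr 2
      ring
    -- After multiplication by `exp (-μ j * u)` the `j`-th term is independent of `t`, so the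
    -- derivative along `A` removes it. The other coefficients are scaled by `μ i - μ j`; only the
    -- factor `μ₀ - μ j` has to be nonzero.
    have hzero : (fun x => H₀ x * (Real.exp ((μ₀ - μ j) * u x) : ℂ) +
        ∑ i ∈ insert j s, H i x * (Real.exp ((μ i - μ j) * u x) : ℂ)) = fun _ => 0 := by
      funext x
      have := congrArg (fun z => z * (Real.exp (-μ j * u x) : ℂ)) (h x)
      simpa only [add_mul, Finset.sum_mul, zero_mul, mul_assoc, hshift] using this
    have hd : ∀ x, ((μ₀ - μ j : ℝ) : ℂ) * H₀ x * (Real.exp ((μ₀ - μ j) * u x) : ℂ) +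
        ∑ i ∈ s, ((μ i - μ j : ℝ) : ℂ) * H i x * (Real.exp ((μ i - μ j) * u x) : ℂ) = 0 := by
      intro x
      have e := congrArg (fun φ => lieDeriv A φ x) hzero
      have e0 : lieDeriv A (fun _ : S => (0 : ℂ)) x = 0 := by
        have := lieDeriv_const_mul A 0 (isSmooth_zero (d := d).mdifferentiable x)
        simpa using this
      have esum : ∀ s' : Finset ι, lieDeriv A (fun x => ∑ i ∈ s', H i x *
          (Real.exp ((μ i - μ j) * u x) : ℂ)) x = ∑ i ∈ s', ((μ i - μ j : ℝ) : ℂ) * H i x *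
          (Real.exp ((μ i - μ j) * u x) : ℂ) := by
        intro s'
        induction s' using Finset.induction_on with
        | empty => simpa using e0
        | insert a s' ha ih' =>
          simp only [Finset.sum_insert ha]
          rw [lieDeriv_add A ((hsmooth _ _ (hH a)).mdifferentiable x)
            ((IsSmooth.sum s' fun i _ => hsmooth _ _ (hH i)).mdifferentiable x), ih',
            hmono _ _ (hH a) (hAH a)]
      simp only [e0] at e
      rw [lieDeriv_add A ((hsmooth _ _ hH₀).mdifferentiable x)
        ((IsSmooth.sum _ fun i _ => hsmooth _ _ (hH i)).mdifferentiable x), hmono _ _ hH₀ hAH₀,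
        esum, Finset.sum_insert hj, sub_self] at e
      simpa using e
    have hμj : μ j ≠ μ₀ := hμ j (Finset.mem_insert_self j s)
    have := ih (fun i hi => hμ i (Finset.mem_insert_of_mem hi))
      (fun i x => ((μ i - μ j : ℝ) : ℂ) * H i x) (fun x => ((μ₀ - μ j : ℝ) : ℂ) * H₀ x)
      (fun i => (hH i).const_mul _) (fun i => hindep _ _ (hH i) (hAH i)) (hH₀.const_mul _)
      (hindep _ _ hH₀ hAH₀) (fun x => by
        have := congrArg (fun z => z * (Real.exp (-(-μ j) * u x) : ℂ)) (hd x)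
        simpa only [add_mul, Finset.sum_mul, zero_mul, mul_assoc, hshift, sub_neg_eq_add,
          sub_add_cancel] using this)
    funext x
    have hx := congrFun this x
    simp only [Pi.zero_apply, mul_eq_zero, Complex.ofReal_eq_zero, sub_eq_zero] at hx
    exact hx.resolve_left fun h => hμj h.symm

end Tension

/-! ### Complete homogeneous sums in reciprocals -/

section CompleteHomogeneous

/-- `∑ ∏ₖ xₖ^(-(ℓₖ + 1))` over all `ℓ` with `ℓ₁ + … + ℓᵢ = j`. -/
def invSum {i : ℕ} (x : Fin i → ℝ) (j : ℕ) : ℝ :=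
  ∑ ℓ ∈ Finset.Nat.antidiagonalTuple i j, (∏ k, x k ^ (ℓ k + 1))⁻¹

lemma sum_antidiagonalTuple_snoc {i : ℕ} (n : ℕ) (f : (Fin (i + 1) → ℕ) → ℝ) :
    ∑ ℓ ∈ Finset.Nat.antidiagonalTuple (i + 1) n, f ℓ =
      ∑ a ∈ Finset.HasAntidiagonal.antidiagonal n, ∑ ℓ ∈ Finset.Nat.antidiagonalTuple i a.2,
        f (Fin.snoc ℓ a.1 : Fin (i + 1) → ℕ) := by
  rw [Finset.sum_sigma']
  refine Finset.sum_bij' (fun ℓ _ => ⟨(ℓ (Fin.last i), ∑ k, Fin.init ℓ k), Fin.init ℓ⟩)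
    (fun z _ => (Fin.snoc z.2 z.1.1 : Fin (i + 1) → ℕ)) ?_ ?_ ?_ ?_ ?_
  · intro ℓ hℓ
    rw [Finset.Nat.mem_antidiagonalTuple, Fin.sum_univ_castSucc] at hℓ
    simp only [Finset.mem_sigma, Finset.HasAntidiagonal.mem_antidiagonal, Finset.Nat.mem_antidiagonalTuple,
      and_true, Fin.init]
    omega
  · rintro ⟨⟨a, b⟩, ℓ⟩ hz
    simp only [Finset.mem_sigma, Finset.HasAntidiagonal.mem_antidiagonal,
      Finset.Nat.mem_antidiagonalTuple] at hz
    rw [Finset.Nat.mem_antidiagonalTuple, Fin.sum_univ_castSucc]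
    simp only [Fin.snoc_castSucc, Fin.snoc_last]
    omega
  · intro ℓ _
    exact Fin.snoc_init_self ℓ
  · rintro ⟨⟨a, b⟩, ℓ⟩ hz
    simp only [Finset.mem_sigma, Finset.HasAntidiagonal.mem_antidiagonal,
      Finset.Nat.mem_antidiagonalTuple] at hz
    obtain ⟨-, rfl⟩ := hz
    simp
  · intro ℓ _
    simp

lemma invSum_snoc {i : ℕ} (x : Fin i → ℝ) (y : ℝ) (n : ℕ) :
    invSum (Fin.snoc x y : Fin (i + 1) → ℝ) n =
      ∑ a ∈ Finset.HasAntidiagonal.antidiagonal n, (y ^ (a.1 + 1))⁻¹ * invSum x a.2 := by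
  rw [invSum, sum_antidiagonalTuple_snoc]
  refine Finset.sum_congr rfl fun a _ => ?_
  rw [invSum, Finset.mul_sum]
  refine Finset.sum_congr rfl fun ℓ _ => ?_
  rw [Fin.prod_univ_castSucc]
  simp only [Fin.snoc_castSucc, Fin.snoc_last]
  rw [mul_inv, mul_comm]

/-- For nonzero entries the generating function `∑ⱼ invSum x j zʲ` is `∏ₖ 1/(xₖ - z)`. Appending `y`
divides it by `y - z`; this lemma and the next compare coefficients. -/
lemma mul_invSum_snoc_zero {i : ℕ} (x : Fin i → ℝ) {y : ℝ} (hy : y ≠ 0) :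
    y * invSum (Fin.snoc x y : Fin (i + 1) → ℝ) 0 = invSum x 0 := by
  rw [invSum_snoc]
  simp [hy]

lemma mul_invSum_snoc_succ {i : ℕ} (x : Fin i → ℝ) {y : ℝ} (hy : y ≠ 0) (n : ℕ) :
    y * invSum (Fin.snoc x y : Fin (i + 1) → ℝ) (n + 1) =
      invSum x (n + 1) + invSum (Fin.snoc x y : Fin (i + 1) → ℝ) n := by
  rw [invSum_snoc, invSum_snoc, Finset.Nat.sum_antidiagonal_succ, mul_add, Finset.mul_sum]
  congr 1
  · field_simp
    ring
  · refine Finset.sum_congr rfl fun a _ => ?_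
    rw [pow_succ y (a.1 + 1)]
    field_simp

lemma invSum_fin_zero (x : Fin 0 → ℝ) (j : ℕ) : invSum x j = if j = 0 then 1 else 0 := by
  cases j <;> simp [invSum]

end CompleteHomogeneous

/-! ### The polynomials in `log t` -/

section AppellPolynomials

/-- The Appell polynomials `∑ⱼ (-2)^j Hⱼ q(q-1)⋯(q-j+1) u^(q-j)`. -/
def appell (H : ℕ → ℝ) (q : ℕ) (u : ℝ) : ℝ :=
  ∑ j ∈ Finset.range (q + 1), (-2) ^ j * H j * (q.descFactorial j : ℝ) * u ^ (q - j)

/-- The polynomial is `H(-2∂)u^q` for the formal series `H(z) = ∑ Hⱼ zʲ`, and `∂` commutes with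
`H(-2∂)`. At `q = 0` the factor `q` hides the truncated index `q - 1`. -/
lemma hasDerivAt_appell (H : ℕ → ℝ) (q : ℕ) (u : ℝ) :
    HasDerivAt (appell H q) (q * appell H (q - 1) u) u := by
  cases q with
  | zero =>
    have : appell H 0 = fun _ => H 0 := by funext u; simp [appell]
    rw [this]
    simpa using hasDerivAt_const u (H 0)
  | succ q =>
    have h : appell H (q + 1) = fun u => (∑ j ∈ Finset.range (q + 1),
        (-2) ^ j * H j * ((q + 1).descFactorial j : ℝ) * u ^ (q + 1 - j)) +
        (-2) ^ (q + 1) * H (q + 1) * ((q + 1).descFactorial (q + 1) : ℝ) := by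
      funext u
      rw [appell, Finset.sum_range_succ]
      simp
    rw [h]
    refine HasDerivAt.add_const _ ?_
    have h1 : ∀ j ∈ Finset.range (q + 1), HasDerivAt (fun u : ℝ =>
        (-2) ^ j * H j * ((q + 1).descFactorial j : ℝ) * u ^ (q + 1 - j))
        ((q + 1 : ℕ) * ((-2) ^ j * H j * (q.descFactorial j : ℝ) * u ^ (q - j))) u := by
      intro j hj
      have hj' : j ≤ q := Nat.lt_succ_iff.1 (Finset.mem_range.1 hj)
      refine ((hasDerivAt_pow (q + 1 - j) u).const_mul _).congr_deriv ?_
      have e1 : ((q + 1 - j : ℕ) : ℝ) * ((q + 1).descFactorial j : ℝ) =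
          (q + 1 : ℕ) * (q.descFactorial j : ℝ) := by
        rw [← Nat.cast_mul, ← Nat.cast_mul, ← Nat.descFactorial_succ, Nat.succ_descFactorial_succ]
      have e2 : q + 1 - j - 1 = q - j := by omega
      rw [e2]
      linear_combination ((-2) ^ j * H j * u ^ (q - j)) * e1
    refine (HasDerivAt.fun_sum h1).congr_deriv ?_
    rw [← Finset.mul_sum]
    rfl

/-- The hypotheses say `(y - z)H(z) = H'(z)`; substituting `z = -2∂` and applying the result to
`u^q` gives the claim. -/
lemma appell_recurrence {H H' : ℕ → ℝ} {y : ℝ} (h0 : y * H 0 = H' 0)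
    (hs : ∀ j, y * H (j + 1) = H' (j + 1) + H j) (q : ℕ) (u : ℝ) :
    y * appell H q u + 2 * q * appell H (q - 1) u = appell H' q u := by
  cases q with
  | zero => simp [appell, h0]
  | succ q =>
    simp only [appell, add_tsub_cancel_right]
    rw [Finset.sum_range_succ' _ (q + 1), Finset.sum_range_succ' _ (q + 1), mul_add,
      Finset.mul_sum, Finset.mul_sum, add_right_comm, ← Finset.sum_add_distrib]
    congr 1
    · refine Finset.sum_congr rfl fun j _ => ?_
      rw [Nat.succ_descFactorial_succ, Nat.add_sub_add_right]
      push_cast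
      linear_combination ((-2) ^ (j + 1) * ((q + 1) * (q.descFactorial j : ℝ)) * u ^ (q - j)) * hs j
    · simp only [pow_zero, one_mul]
      rw [← h0]
      ring

lemma contDiff_appell (H : ℕ → ℝ) (q : ℕ) : ContDiff ℝ ∞ (appell H q) := by
  unfold appell
  exact ContDiff.sum fun j _ => contDiff_const.mul (contDiff_id.pow _)

end AppellPolynomials

/-! ### The functions attached to the nodes and their differential equation -/

section NodeFunctions

variable {d : ℕ} {S : Type*} [TopologicalSpace S] [ChartedSpace (EuclideanSpace ℝ (Fin d)) S]
  [Group S] [LieGroup (𝓡 d) ∞ S] {A : LieAlg d S}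

lemma LamTop_snoc {i : ℕ} (α : Fin i → Eig A) (k : Eig A) :
    LamTop (Fin.snoc α k : Fin (i + 1) → Eig A) = LamTop α + lam k := by
  simp [LamTop, Fin.sum_univ_castSucc]

lemma Lam_last {i : ℕ} (α : Fin (i + 1) → Eig A) : Lam α (Fin.last i) = LamTop α := by
  rw [Lam, LamTop]
  congr 1
  ext j
  simp [Fin.le_last]

lemma Lam_snoc_castSucc {i : ℕ} (α : Fin i → Eig A) (k : Eig A) (j : Fin i) :
    Lam (Fin.snoc α k : Fin (i + 1) → Eig A) j.castSucc = Lam α j := by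
  rw [Lam, Lam]
  symm
  refine Finset.sum_bij (fun a _ => a.castSucc) ?_ ?_ ?_ ?_
  · intro a ha
    simpa using ha
  · intro a _ b _ h
    exact Fin.castSucc_injective _ h
  · intro b hb
    have hb' : b ≤ j.castSucc := Finset.mem_Iic.1 hb
    have hlt : b.val < i := lt_of_le_of_lt hb' j.2
    exact ⟨⟨b, hlt⟩, Finset.mem_Iic.2 hb', rfl⟩
  · intro a _
    simp

lemma LamTop_nonneg (hlam : ∀ k : Eig A, 0 < lam k) {i : ℕ} (α : Fin i → Eig A) :
    0 ≤ LamTop α := Finset.sum_nonneg fun j _ => (hlam (α j)).le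

lemma LamTop_pos (hlam : ∀ k : Eig A, 0 < lam k) {i : ℕ} (α : Fin (i + 1) → Eig A) :
    0 < LamTop α := Finset.sum_pos (fun j _ => hlam (α j)) Finset.univ_nonempty

lemma Lam_pos (hlam : ∀ k : Eig A, 0 < lam k) {i : ℕ} (α : Fin i → Eig A) (k : Fin i) :
    0 < Lam α k := Finset.sum_pos (fun j _ => hlam (α j)) ⟨k, Finset.mem_Iic.2 le_rfl⟩

/-- The constant `(-1/2)^i / ∏ₖ Λᵏ`. -/
def nodeConst {i : ℕ} (α : Fin i → Eig A) : ℝ := (-1 / 2) ^ i / ∏ k, Lam α k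

lemma nodeConst_snoc (hlam : ∀ k : Eig A, 0 < lam k) {i : ℕ} (α : Fin i → Eig A) (k : Eig A) :
    2 * LamTop (Fin.snoc α k : Fin (i + 1) → Eig A) *
      nodeConst (Fin.snoc α k : Fin (i + 1) → Eig A) = -nodeConst α := by
  have h1 := (LamTop_pos hlam (Fin.snoc α k : Fin (i + 1) → Eig A)).ne'
  have h2 : ∏ k, Lam α k ≠ 0 := Finset.prod_ne_zero_iff.2 fun j _ => (Lam_pos hlam α j).ne'
  rw [nodeConst, nodeConst, Fin.prod_univ_castSucc, Lam_last]
  simp only [Lam_snoc_castSucc]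
  field_simp
  ring

/-- The coefficients of the polynomial in `log t` at a node. -/
def nodeCoeff (c : ℝ) {i : ℕ} (α : Fin i → Eig A) : ℕ → ℝ := invSum fun k => 2 * Lam α k + c

lemma nodeCoeff_snoc (c : ℝ) {i : ℕ} (α : Fin i → Eig A) (k : Eig A) :
    nodeCoeff c (Fin.snoc α k : Fin (i + 1) → Eig A) =
      invSum (Fin.snoc (fun j => 2 * Lam α j + c)
        (2 * LamTop (Fin.snoc α k : Fin (i + 1) → Eig A) + c) : Fin (i + 1) → ℝ) := by
  unfold nodeCoeff
  congr 1
  funext j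
  refine Fin.lastCases ?_ (fun j => ?_) j
  · rw [Fin.snoc_last, Lam_last]
  · rw [Fin.snoc_castSucc, Lam_snoc_castSucc]

/-- The function of `u = log t` which multiplies a node. -/
def nodeFun (b c : ℝ) {i : ℕ} (α : Fin i → Eig A) (q : ℕ) (u : ℝ) : ℝ :=
  nodeConst α * Real.exp ((2 * LamTop α + b) * u) * appell (nodeCoeff c α) q u

/-- The first derivative of `nodeFun`. -/
def nodeFun' (b c : ℝ) {i : ℕ} (α : Fin i → Eig A) (q : ℕ) (u : ℝ) : ℝ :=
  (2 * LamTop α + b) * nodeFun b c α q u + q * nodeFun b c α (q - 1) u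

/-- The second derivative of `nodeFun`. -/
def nodeFun'' (b c : ℝ) {i : ℕ} (α : Fin i → Eig A) (q : ℕ) (u : ℝ) : ℝ :=
  (2 * LamTop α + b) * nodeFun' b c α q u + q * nodeFun' b c α (q - 1) u

lemma contDiff_nodeFun (b c : ℝ) {i : ℕ} (α : Fin i → Eig A) (q : ℕ) :
    ContDiff ℝ ∞ (nodeFun b c α q) :=
  (contDiff_const.mul (contDiff_const.mul contDiff_id).exp).mul (contDiff_appell _ q)

lemma hasDerivAt_nodeFun (b c : ℝ) {i : ℕ} (α : Fin i → Eig A) (q : ℕ) (u : ℝ) :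
    HasDerivAt (nodeFun b c α q) (nodeFun' b c α q u) u := by
  refine (((((hasDerivAt_id u).const_mul (2 * LamTop α + b)).exp).const_mul
    (nodeConst α)).mul (hasDerivAt_appell (nodeCoeff c α) q u)).congr_deriv ?_
  simp only [nodeFun', nodeFun, id]
  ring

lemma hasDerivAt_nodeFun' (b c : ℝ) {i : ℕ} (α : Fin i → Eig A) (q : ℕ) (u : ℝ) :
    HasDerivAt (nodeFun' b c α q) (nodeFun'' b c α q u) u :=
  ((hasDerivAt_nodeFun b c α q u).const_mul _).add
    ((hasDerivAt_nodeFun b c α (q - 1) u).const_mul _)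

/-- At the root the function is `e^{bu}u^q`; there is no parent, hence no source term. -/
lemma nodeFun_ode_zero {b c n : ℝ} (hb : b * (b - n) = 0) (hc : c = 2 * b - n)
    (α : Fin 0 → Eig A) (q : ℕ) (u : ℝ) :
    nodeFun'' b c α q u - n * nodeFun' b c α q u =
      c * q * nodeFun b c α (q - 1) u +
        q * ((q - 1 : ℕ) : ℝ) * nodeFun b c α (q - 1 - 1) u := by
  have h : LamTop α = 0 := by simp [LamTop]
  simp only [nodeFun'', nodeFun', h, hc]
  linear_combination nodeFun b (2 * b - n) α q u * hb

/-- With `s = 2Λ + b` one has `s² - ns = 2Λ(2Λ + c)` and `2s - n = 4Λ + c`. The terms with factor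
`2Λ` combine to `2Λ((2Λ + c)P_q + 2qP_{q-1})`, which by `appell_recurrence` is `2Λ` times the parent
polynomial. Since `2Λ` times the new constant is minus the parent constant, this is the source term.
-/
lemma nodeFun_ode_snoc (hlam : ∀ k : Eig A, 0 < lam k) {b c n : ℝ} (hb : b * (b - n) = 0)
    (hc : c = 2 * b - n) {i : ℕ} (α : Fin i → Eig A) (k : Eig A)
    (hne : 2 * LamTop (Fin.snoc α k : Fin (i + 1) → Eig A) + c ≠ 0) (q : ℕ) (u : ℝ) :
    nodeFun'' b c (Fin.snoc α k : Fin (i + 1) → Eig A) q u -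
        n * nodeFun' b c (Fin.snoc α k : Fin (i + 1) → Eig A) q u =
      c * q * nodeFun b c (Fin.snoc α k : Fin (i + 1) → Eig A) (q - 1) u +
        q * ((q - 1 : ℕ) : ℝ) * nodeFun b c (Fin.snoc α k : Fin (i + 1) → Eig A) (q - 1 - 1) u -
        Real.exp (2 * lam k * u) * nodeFun b c α q u := by
  have hrec := appell_recurrence (H := nodeCoeff c (Fin.snoc α k : Fin (i + 1) → Eig A))
    (H' := nodeCoeff c α) (y := 2 * LamTop (Fin.snoc α k : Fin (i + 1) → Eig A) + c)
    (by rw [nodeCoeff_snoc]; exact mul_invSum_snoc_zero _ hne)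
    (fun j => by rw [nodeCoeff_snoc]; exact mul_invSum_snoc_succ _ hne j) q u
  have hconst := nodeConst_snoc hlam α k
  have hexp : Real.exp ((2 * LamTop (Fin.snoc α k : Fin (i + 1) → Eig A) + b) * u) =
      Real.exp (2 * lam k * u) * Real.exp ((2 * LamTop α + b) * u) := by
    rw [LamTop_snoc, ← Real.exp_add]
    congr 1
    ring
  simp only [nodeFun'', nodeFun']
  simp only [nodeFun, hexp]
  set α' := (Fin.snoc α k : Fin (i + 1) → Eig A)
  set e := Real.exp (2 * lam k * u) * Real.exp ((2 * LamTop α + b) * u) with he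
  rw [← hrec]
  generalize appell (nodeCoeff c α') q u = P0
  generalize appell (nodeCoeff c α') (q - 1) u = P1
  generalize appell (nodeCoeff c α') (q - 1 - 1) u = P2
  have hα : nodeConst α = -(2 * LamTop α' * nodeConst α') := by rw [hconst, neg_neg]
  rw [hα]
  subst hc
  linear_combination (nodeConst α' * e * P0) * hb + (-(2 * LamTop α' * nodeConst α') *
    ((2 * LamTop α' + (2 * b - n)) * P0 + 2 * q * P1)) * he

/-- For `p = q + 1` the product of the `p - k` is a falling factorial of `q`. The powers regroup as
`(-1/2)^i` for the node constant and `(-2)^j` for the Appell polynomial. -/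
lemma coeff_eq (i j q : ℕ) :
    (-1 : ℝ) ^ (i + j) * (2 : ℝ) ^ ((j : ℤ) - (i : ℤ)) *
      ∏ k ∈ Finset.Icc 1 j, (((q + 1 : ℕ) : ℝ) - (k : ℝ)) =
    (-1 / 2) ^ i * ((-2) ^ j * (q.descFactorial j : ℝ)) := by
  have h1 : ∏ k ∈ Finset.Icc 1 j, (((q + 1 : ℕ) : ℝ) - (k : ℝ)) = (q.descFactorial j : ℝ) := by
    induction j with
    | zero => simp
    | succ j ih =>
      rw [Finset.prod_Icc_succ_top (by omega), ih, Nat.descFactorial_succ]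
      rcases le_or_gt j q with h | h
      · push_cast [Nat.cast_sub h]
        ring
      · rw [Nat.descFactorial_of_lt h]
        simp
  rw [h1, zpow_sub₀ two_ne_zero, zpow_natCast, zpow_natCast, pow_add, div_pow, neg_pow 2 j]
  ring

lemma nodeFun_eq_sum (b c : ℝ) {i : ℕ} (α : Fin i → Eig A) (q : ℕ) {s : ℝ} (hs : 0 < s) :
    s ^ (2 * LamTop α + b) / (∏ k, Lam α k) *
      ∑ j ∈ Finset.range (q + 1), ∑ ℓ ∈ Finset.Nat.antidiagonalTuple i j,
        ((-1 : ℝ) ^ (i + j) * (2 : ℝ) ^ ((j : ℤ) - (i : ℤ)) *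
          ∏ k ∈ Finset.Icc 1 j, (((q + 1 : ℕ) : ℝ) - (k : ℝ))) /
        (∏ k, (2 * Lam α k + c) ^ (ℓ k + 1)) * Real.log s ^ (q + 1 - 1 - j) =
      nodeFun b c α q (Real.log s) := by
  rw [nodeFun, nodeConst, appell, Real.rpow_def_of_pos hs, mul_comm (Real.log s)]
  simp only [coeff_eq, nodeCoeff, invSum, Finset.mul_sum, Finset.sum_mul, add_tsub_cancel_right]
  refine Finset.sum_congr rfl fun j _ => Finset.sum_congr rfl fun ℓ _ => ?_
  ring

lemma fFun_eq {i : ℕ} (α : Fin i → Eig A) (q : ℕ) {s : ℝ} (hs : 0 < s) :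
    fFun α s (q + 1) = nodeFun 0 (-nn A) α q (Real.log s) := by
  rw [← nodeFun_eq_sum _ _ _ _ hs, add_zero]
  rfl

lemma gFun_eq {i : ℕ} (α : Fin i → Eig A) (q : ℕ) {s : ℝ} (hs : 0 < s) :
    gFun α s (q + 1) = nodeFun (nn A) (nn A) α q (Real.log s) :=
  nodeFun_eq_sum _ _ _ _ hs

lemma nodeFun_fin_zero (b c : ℝ) (α : Fin 0 → Eig A) (q : ℕ) (u : ℝ) :
    nodeFun b c α q u = Real.exp (b * u) * u ^ q := by
  simp [nodeFun, nodeConst, LamTop, appell, nodeCoeff, invSum_fin_zero]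

end NodeFunctions

/-! ### Powers of an operator with a lowering recursion -/

section Recursion

variable {M : Type*} [AddCommGroup M] [Module ℂ M] {T : Module.End ℂ M} {c : ℂ} {e : ℕ → M}

lemma pow_apply_eq_zero_of_recursion
    (he : ∀ q, T (e q) = (c * q) • e (q - 1) + ((q : ℂ) * ((q - 1 : ℕ) : ℂ)) • e (q - 1 - 1))
    (q m : ℕ) (hm : q < m) : (T ^ m) (e q) = 0 := by
  induction m generalizing q with
  | zero => omega
  | succ m ih =>
    rw [pow_succ, Module.End.mul_apply, he, map_add, map_smul, map_smul]
    cases q with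
    | zero => simp
    | succ q => rw [ih _ (by omega), ih _ (by omega), smul_zero, smul_zero, add_zero]

/-- After `q` steps only the path lowering the index by one each time survives; a drop by two leaves
too many powers of `T`. -/
lemma pow_apply_of_recursion
    (he : ∀ q, T (e q) = (c * q) • e (q - 1) + ((q : ℂ) * ((q - 1 : ℕ) : ℂ)) • e (q - 1 - 1))
    (q : ℕ) : (T ^ q) (e q) = (c ^ q * (q.factorial : ℂ)) • e 0 := by
  induction q with
  | zero => simp
  | succ q ih =>
    rw [pow_succ, Module.End.mul_apply, he, map_add, map_smul, map_smul, add_tsub_cancel_right, ih]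
    have h : ((((q + 1 : ℕ) : ℂ) * ((q : ℕ) : ℂ))) • (T ^ q) (e (q - 1)) = 0 := by
      cases q with
      | zero => simp
      | succ q => rw [pow_apply_eq_zero_of_recursion he _ _ (by omega), smul_zero]
    rw [h, add_zero, smul_smul, Nat.factorial_succ]
    congr 1
    push_cast
    ring

end Recursion

/-! ### Tree sums, independence and proper harmonicity -/

section Harmonic

variable {d : ℕ} {S : Type*} [TopologicalSpace S] [ChartedSpace (EuclideanSpace ℝ (Fin d)) S]
  [Group S] [LieGroup (𝓡 d) ∞ S]

lemma IsSmooth.tau (g : Metric d S) {φ : S → ℂ} (hφ : IsSmooth (d := d) φ) :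
    IsSmooth (d := d) (tau g φ) := by
  refine IsSmooth.sum _ fun a _ => ?_
  have h := ((hφ.lieDeriv (onb g a)).lieDeriv (onb g a)).add
    ((hφ.lieDeriv (leviCivita g (onb g a) (onb g a))).const_mul (-1))
  simpa only [neg_one_mul, ← sub_eq_add_neg] using h

variable (d S) in
/-- The space of smooth complex-valued functions. -/
def smoothFunctions : Submodule ℂ (S → ℂ) where
  carrier := {φ | IsSmooth (d := d) φ}
  zero_mem' := isSmooth_zero
  add_mem' := fun h h' => IsSmooth.add h h'
  smul_mem' := fun c _ h => IsSmooth.const_mul c h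

/-- The Laplace-Beltrami operator on smooth functions. -/
def tauEnd (g : Metric d S) : Module.End ℂ (smoothFunctions d S) where
  toFun φ := ⟨tau g φ, IsSmooth.tau g φ.2⟩
  map_add' φ ψ := Subtype.ext (funext fun x => tau_add g φ.2 ψ.2 x)
  map_smul' c φ := Subtype.ext (funext fun x => tau_const_mul g c φ.2 x)

lemma iterate_tau_eq (g : Metric d S) (m : ℕ) (φ : smoothFunctions d S) :
    (tau g)^[m] (φ : S → ℂ) = ((tauEnd g ^ m) φ : smoothFunctions d S) := by
  induction m with
  | zero => rfl
  | succ m ih => rw [Function.iterate_succ_apply', ih, pow_succ']; rfl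

variable {g : Metric d S} {A : LieAlg d S} {u : S → ℝ} {h : S → ℂ}
  {node : (i : ℕ) → (Fin i → Eig A) → S → ℂ}

/-- The common form of the functions `φ` and `ψ`. -/
def treeSum (u : S → ℝ) (node : (i : ℕ) → (Fin i → Eig A) → S → ℂ) (r : ℕ) (b c : ℝ) (q : ℕ)
    (x : S) : ℂ :=
  ∑ i ∈ Finset.range (r + 1), ∑ α : Fin i → Eig A, node i α x * (nodeFun b c α q (u x) : ℂ)

lemma isSmooth_treeSum (hu : IsLogCoordinate g A u)
    (hsm : ∀ i α, IsSmooth (d := d) (node i α)) (r : ℕ) (b c : ℝ) (q : ℕ) :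
    IsSmooth (d := d) (treeSum u node r b c q) :=
  IsSmooth.sum _ fun i _ => IsSmooth.sum _ fun α _ =>
    (hsm i α).mul_comp hu.smooth (contDiff_nodeFun b c α q)

/-- `τ` of a level-`i` node produces level-`i + 1` nodes times `e^{2λ_k u}`; the source terms of the
differential equation one level deeper cancel them, so the sum over levels telescopes. -/
lemma tau_treeSum (hu : IsLogCoordinate g A u) (hrank : rank g = 1) (hA : IsUnitPositive g A)
    (hsm : ∀ i α, IsSmooth (d := d) (node i α)) (hind : ∀ i α, IndepOfT A (node i α))
    (hten : ∀ i α x, tau g (node i α) x = ∑ k : Eig A,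
      node (i + 1) (Fin.snoc α k : Fin (i + 1) → Eig A) x * (Real.exp (2 * lam k * u x) : ℂ))
    {r : ℕ} (hr : ∀ α : Fin (r + 1) → Eig A, node (r + 1) α = 0) {b c : ℝ}
    (hb : b * (b - trAd A) = 0) (hc : c = 2 * b - trAd A)
    (hne : ∀ i (α : Fin (i + 1) → Eig A), node (i + 1) α ≠ 0 → 2 * LamTop α + c ≠ 0)
    (q : ℕ) (x : S) :
    tau g (treeSum u node r b c q) x = ((c : ℂ) * q) * treeSum u node r b c (q - 1) x +
      ((q : ℂ) * ((q - 1 : ℕ) : ℂ)) * treeSum u node r b c (q - 1 - 1) x := by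
  have hsm' : ∀ i α, IsSmooth (d := d) fun y =>
      node i α y * (nodeFun b c α q (u y) : ℂ) := fun i α =>
    (hsm i α).mul_comp hu.smooth (contDiff_nodeFun b c α q)
  -- the contributions which cancel between consecutive levels
  let G : ℕ → ℂ := fun i => match i with
    | 0 => 0
    | i + 1 => ∑ α : Fin i → Eig A, ∑ k : Eig A,
        node (i + 1) (Fin.snoc α k : Fin (i + 1) → Eig A) x *
          (Real.exp (2 * lam k * u x) : ℂ) * (nodeFun b c α q (u x) : ℂ)
  have hlam := lam_pos hA.pos
  have hlevel : ∀ i, ∑ α : Fin i → Eig A,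
      tau g (fun y => node i α y * (nodeFun b c α q (u y) : ℂ)) x =
      ((c : ℂ) * q) * ∑ α : Fin i → Eig A, node i α x * (nodeFun b c α (q - 1) (u x) : ℂ) +
      ((q : ℂ) * ((q - 1 : ℕ) : ℂ)) *
        ∑ α : Fin i → Eig A, node i α x * (nodeFun b c α (q - 1 - 1) (u x) : ℂ) +
      (G (i + 1) - G i) := by
    intro i
    have h1 : ∀ α : Fin i → Eig A, tau g (fun y => node i α y * (nodeFun b c α q (u y) : ℂ)) x =
        (∑ k : Eig A, node (i + 1) (Fin.snoc α k : Fin (i + 1) → Eig A) x *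
          (Real.exp (2 * lam k * u x) : ℂ) * (nodeFun b c α q (u x) : ℂ)) +
        node i α x * ((nodeFun'' b c α q (u x) - trAd A * nodeFun' b c α q (u x) : ℝ) : ℂ) := by
      intro α
      rw [hu.tau_mul_comp hrank hA (hsm i α) (hind i α) (hasDerivAt_nodeFun b c α q)
        (hasDerivAt_nodeFun' b c α q), hten, Finset.sum_mul]
    suffices h5 : ∑ α : Fin i → Eig A, node i α x *
        ((nodeFun'' b c α q (u x) - trAd A * nodeFun' b c α q (u x) : ℝ) : ℂ) =
        ((c : ℂ) * q) * ∑ α : Fin i → Eig A, node i α x * (nodeFun b c α (q - 1) (u x) : ℂ) +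
        ((q : ℂ) * ((q - 1 : ℕ) : ℂ)) *
          ∑ α : Fin i → Eig A, node i α x * (nodeFun b c α (q - 1 - 1) (u x) : ℂ) - G i by
      rw [Finset.sum_congr rfl fun α _ => h1 α, Finset.sum_add_distrib, h5]
      change G (i + 1) + _ = _
      ring
    rw [Finset.mul_sum, Finset.mul_sum, ← Finset.sum_add_distrib]
    cases i with
    | zero =>
      have h2 : ∀ α : Fin 0 → Eig A, node 0 α x *
          ((nodeFun'' b c α q (u x) - trAd A * nodeFun' b c α q (u x) : ℝ) : ℂ) =
          (c : ℂ) * q * (node 0 α x * (nodeFun b c α (q - 1) (u x) : ℂ)) +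
          (q : ℂ) * ((q - 1 : ℕ) : ℂ) * (node 0 α x * (nodeFun b c α (q - 1 - 1) (u x) : ℂ)) := by
        intro α
        rw [nodeFun_ode_zero hb hc]
        push_cast
        ring
      rw [Finset.sum_congr rfl fun α _ => h2 α]
      exact (sub_zero _).symm
    | succ i =>
      have h2 : ∀ (α : Fin i → Eig A) (k : Eig A),
          node (i + 1) (Fin.snoc α k : Fin (i + 1) → Eig A) x *
          ((nodeFun'' b c (Fin.snoc α k : Fin (i + 1) → Eig A) q (u x) -
            trAd A * nodeFun' b c (Fin.snoc α k : Fin (i + 1) → Eig A) q (u x) : ℝ) : ℂ) =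
          ((c : ℂ) * q * (node (i + 1) (Fin.snoc α k : Fin (i + 1) → Eig A) x *
            (nodeFun b c (Fin.snoc α k : Fin (i + 1) → Eig A) (q - 1) (u x) : ℂ)) +
          (q : ℂ) * ((q - 1 : ℕ) : ℂ) * (node (i + 1) (Fin.snoc α k : Fin (i + 1) → Eig A) x *
            (nodeFun b c (Fin.snoc α k : Fin (i + 1) → Eig A) (q - 1 - 1) (u x) : ℂ))) -
          node (i + 1) (Fin.snoc α k : Fin (i + 1) → Eig A) x *
            (Real.exp (2 * lam k * u x) : ℂ) * (nodeFun b c α q (u x) : ℂ) := by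
        intro α k
        -- At a vanishing node `2Λ + c` may be zero and the differential equation may fail, but both
        -- sides carry the factor `0`.
        by_cases h0 : node (i + 1) (Fin.snoc α k : Fin (i + 1) → Eig A) = 0
        · simp [h0]
        · rw [nodeFun_ode_snoc hlam hb hc α k (hne i _ h0)]
          push_cast
          ring
      have hsplit : ∀ f : (Fin (i + 1) → Eig A) → ℂ, ∑ β, f β =
          ∑ α : Fin i → Eig A, ∑ k : Eig A, f (Fin.snoc α k : Fin (i + 1) → Eig A) := by
        intro f
        rw [← (Fin.snocEquiv fun _ : Fin (i + 1) => Eig A).sum_comp, Fintype.sum_prod_type,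
          Finset.sum_comm]
        rfl
      rw [hsplit, hsplit]
      simp only [h2, Finset.sum_sub_distrib]
      rfl
  -- Finite degree: the contribution leaving level `r` involves only nodes that vanish.
  have hG : G (r + 1) = 0 := by
    change ∑ α : Fin r → Eig A, ∑ k : Eig A, node (r + 1) (Fin.snoc α k : Fin (r + 1) → Eig A) x *
      (Real.exp (2 * lam k * u x) : ℂ) * (nodeFun b c α q (u x) : ℂ) = 0
    simp [hr]
  have h3 : tau g (treeSum u node r b c q) x = ∑ i ∈ Finset.range (r + 1), ∑ α : Fin i → Eig A,
      tau g (fun y => node i α y * (nodeFun b c α q (u y) : ℂ)) x := by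
    unfold treeSum
    rw [tau_sum g _ fun i _ => IsSmooth.sum _ fun α _ => hsm' i α]
    exact Finset.sum_congr rfl fun i _ => tau_sum g _ (fun α _ => hsm' i α) x
  rw [h3, Finset.sum_congr rfl fun i _ => hlevel i, Finset.sum_add_distrib,
    Finset.sum_add_distrib, ← Finset.mul_sum, ← Finset.mul_sum, Finset.sum_range_sub, hG]
  change _ + (0 - 0) = _
  rw [sub_zero, add_zero]
  rfl

/-- Terms with zero coefficient are discarded first, so coinciding exponents matter only where the
coefficients are nonzero. -/
lemma IsLogCoordinate.coeff_eq_zero_of_sum_exp (hu : IsLogCoordinate g A u)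
    (hA : IsUnitPositive g A) {ι : Type*} (s : Finset ι) (μ : ι → ℝ) (H : ι → S → ℂ) {i₀ : ι}
    (hi₀ : i₀ ∈ s) (hμ : ∀ i ∈ s, i ≠ i₀ → μ i = μ i₀ → H i = 0)
    (hH : ∀ i, IsSmooth (d := d) (H i)) (hAH : ∀ i, IndepOfT A (H i))
    (h : ∀ x, ∑ i ∈ s, H i x * (Real.exp (μ i * u x) : ℂ) = 0) : H i₀ = 0 := by
  classical
  refine hu.eq_zero_of_sum_exp hA ((s.erase i₀).filter fun i => H i ≠ 0) μ (μ i₀) ?_ H (H i₀) hH hAH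
    (hH i₀) (hAH i₀) fun x => ?_
  · intro i hi he
    rw [Finset.mem_filter, Finset.mem_erase] at hi
    exact hi.2 (hμ i hi.1.2 hi.1.1 he)
  · rw [Finset.sum_filter_of_ne, Finset.add_sum_erase s (fun i =>
      H i x * (Real.exp (μ i * u x) : ℂ)) hi₀]
    · exact h x
    · intro i _ hne h0
      simp [h0] at hne

lemma IndepOfT.const_mul {φ : S → ℂ} (hφ : IsSmooth (d := d) φ) (hA : IndepOfT A φ) (z : ℂ) :
    IndepOfT A fun x => z * φ x := fun x => by
  rw [lieDeriv_const_mul A z (hφ.mdifferentiable x), hA x, mul_zero]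

lemma appell_zero (H : ℕ → ℝ) (v : ℝ) : appell H 0 v = H 0 := by simp [appell]

/-- The functions `φ₁` and `ψ₁` are linearly independent. -/
lemma treeSum_zero_comb_ne_zero (hu : IsLogCoordinate g A u) (hA : IsUnitPositive g A)
    (hsm : ∀ i α, IsSmooth (d := d) (node i α)) (hind : ∀ i α, IndepOfT A (node i α))
    (hroot : ∀ α, node 0 α ≠ 0) (r : ℕ) {n c c' : ℝ} (hn : 0 < n) {a b : ℂ}
    (hab : a ≠ 0 ∨ b ≠ 0) :
    (fun x => a * treeSum u node r 0 c 0 x + b * treeSum u node r n c' 0 x) ≠ 0 := by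
  intro h0
  let s : Finset (Σ i : ℕ, Fin i → Eig A) := (Finset.range (r + 1)).sigma fun i => Finset.univ
  let z : Bool × (Σ i : ℕ, Fin i → Eig A) → ℂ := fun p => if p.1
    then b * ((nodeConst p.2.2 * nodeCoeff c' p.2.2 0 : ℝ) : ℂ)
    else a * ((nodeConst p.2.2 * nodeCoeff c p.2.2 0 : ℝ) : ℂ)
  let H : Bool × (Σ i : ℕ, Fin i → Eig A) → S → ℂ := fun p x => z p * node p.2.1 p.2.2 x
  let μ : Bool × (Σ i : ℕ, Fin i → Eig A) → ℝ := fun p => 2 * LamTop p.2.2 + if p.1 then n else 0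
  have hlam := lam_pos hA.pos
  have hsum : ∀ x, ∑ p ∈ Finset.univ ×ˢ s, H p x * (Real.exp (μ p * u x) : ℂ) = 0 := by
    intro x
    have hx := congrFun h0 x
    rw [Finset.sum_product, Fintype.sum_bool, add_comm]
    refine Eq.trans ?_ hx
    simp only [treeSum, nodeFun, appell_zero, s, Finset.sum_sigma, Finset.mul_sum]
    congr 1 <;>
    · refine Finset.sum_congr rfl fun i _ => Finset.sum_congr rfl fun α _ => ?_
      simp only [H, z, μ, if_true, Bool.false_eq_true, if_false]
      push_cast
      ring
  have hHsm : ∀ p, IsSmooth (d := d) (H p) := fun p => (hsm p.2.1 p.2.2).const_mul _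
  have hHind : ∀ p, IndepOfT A (H p) := fun p => IndepOfT.const_mul (hsm _ _) (hind _ _) _
  have hroot' : ∀ t : Bool, (if t then b else a) ≠ 0 →
      H (t, ⟨0, Fin.elim0⟩) ≠ 0 := by
    intro t ht hH
    refine hroot Fin.elim0 (funext fun x => ?_)
    have hx := congrFun hH x
    have hz : z (t, ⟨0, Fin.elim0⟩) = if t then b else a := by
      cases t <;> simp [z, nodeConst, nodeCoeff, invSum_fin_zero]
    simp only [H, hz, Pi.zero_apply, mul_eq_zero] at hx
    exact hx.resolve_left ht
  have hmem : ∀ t : Bool, ((t, ⟨0, Fin.elim0⟩) : Bool × (Σ i : ℕ, Fin i → Eig A)) ∈ Finset.univ ×ˢ s := fun t =>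
    Finset.mem_product.2 ⟨Finset.mem_univ _, Finset.mem_sigma.2 ⟨by simp, Finset.mem_univ _⟩⟩
  have hLam0 : ∀ α : Fin 0 → Eig A, LamTop α = 0 := fun α => by simp [LamTop]
  have hzero : ∀ (t : Bool) (α : Fin 0 → Eig A),
      ((t, ⟨0, α⟩) : Bool × (Σ i : ℕ, Fin i → Eig A)) = (t, ⟨0, Fin.elim0⟩) := fun t α => by
    rw [Subsingleton.elim α Fin.elim0]
  -- A root term is isolated by its exponent. If `a = 0`, the second sum has root exponent `n` and
  -- all its other exponents are larger; exponents of the first sum may equal `n`, but their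
  -- coefficients vanish. If `a ≠ 0`, the exponent `0` of the first root lies strictly below all
  -- others.
  by_cases ha : a = 0
  · refine hroot' true (by simpa using hab.resolve_left (by simpa using ha)) ?_
    refine hu.coeff_eq_zero_of_sum_exp hA _ μ H (hmem true) ?_ hHsm hHind hsum
    rintro ⟨t, ⟨i, α⟩⟩ - hne hμ
    cases t with
    | false =>
      funext x
      simp [H, z, ha]
    | true =>
      cases i with
      | zero => exact absurd (hzero true α) hne
      | succ i =>
        have := LamTop_pos hlam α
        simp only [μ, hLam0, if_true] at hμ
        linarith
  · refine hroot' false (by simpa using ha) ?_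
    refine hu.coeff_eq_zero_of_sum_exp hA _ μ H (hmem false) ?_ hHsm hHind hsum
    rintro ⟨t, ⟨i, α⟩⟩ - hne hμ
    cases t with
    | true =>
      have := LamTop_nonneg hlam α
      simp only [μ, hLam0, if_true, Bool.false_eq_true, if_false] at hμ
      linarith
    | false =>
      cases i with
      | zero => exact absurd (hzero false α) hne
      | succ i =>
        have := LamTop_pos hlam α
        simp only [μ, hLam0, Bool.false_eq_true, if_false] at hμ
        linarith

/-- A combination of two sequences of smooth functions on which `τ` acts like on
`log(t)^q` and `t^n log(t)^q`. -/
lemma isProperPHarmonic_comb {e e' : ℕ → S → ℂ} {n : ℝ} (hn : n ≠ 0) (a b : ℂ)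
    (hsm : ∀ q, IsSmooth (d := d) (e q)) (hsm' : ∀ q, IsSmooth (d := d) (e' q))
    (he : ∀ q, a ≠ 0 → ∀ x, tau g (e q) x = (((-n : ℝ) : ℂ) * q) * e (q - 1) x +
      ((q : ℂ) * ((q - 1 : ℕ) : ℂ)) * e (q - 1 - 1) x)
    (he' : ∀ q x, tau g (e' q) x = ((n : ℂ) * q) * e' (q - 1) x +
      ((q : ℂ) * ((q - 1 : ℕ) : ℂ)) * e' (q - 1 - 1) x)
    (h0 : ∀ a' b' : ℂ, (a' ≠ 0 ↔ a ≠ 0) → (b' ≠ 0 ↔ b ≠ 0) →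
      (fun x => a' * e 0 x + b' * e' 0 x) ≠ 0) (q : ℕ) :
    IsProperPHarmonic g (q + 1) (fun x => a * e q x + b * e' q x) := by
  let E : ℕ → smoothFunctions d S := fun q => ⟨e q, hsm q⟩
  let E' : ℕ → smoothFunctions d S := fun q => ⟨e' q, hsm' q⟩
  have hE : a ≠ 0 → ∀ q, tauEnd g (E q) = ((((-n : ℝ) : ℂ)) * q) • E (q - 1) +
      ((q : ℂ) * ((q - 1 : ℕ) : ℂ)) • E (q - 1 - 1) := fun ha q =>
    Subtype.ext (funext fun x => he q ha x)
  have hE' : ∀ q, tauEnd g (E' q) = ((n : ℂ) * q) • E' (q - 1) +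
      ((q : ℂ) * ((q - 1 : ℕ) : ℂ)) • E' (q - 1 - 1) := fun q =>
    Subtype.ext (funext fun x => he' q x)
  have hval : (fun x => a * e q x + b * e' q x) =
      ((a • E q + b • E' q : smoothFunctions d S) : S → ℂ) := rfl
  -- The recursion for `E` is available only for `a ≠ 0`, so that the case `a = 0` needs no
  -- non-degeneracy.
  have hz : a • (tauEnd g ^ (q + 1)) (E q) = 0 := by
    by_cases ha : a = 0
    · rw [ha, zero_smul]
    · rw [pow_apply_eq_zero_of_recursion (hE ha) q (q + 1) (by omega), smul_zero]
  have hq : a • (tauEnd g ^ q) (E q) = (a * (((-n : ℝ) : ℂ) ^ q * (q.factorial : ℂ))) • E 0 := by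
    by_cases ha : a = 0
    · rw [ha, zero_mul, zero_smul, zero_smul]
    · rw [pow_apply_of_recursion (hE ha) q, smul_smul]
  have hnC : (n : ℂ) ≠ 0 := Complex.ofReal_ne_zero.2 hn
  have hfac : (q.factorial : ℂ) ≠ 0 := Nat.cast_ne_zero.2 q.factorial_ne_zero
  refine ⟨((hsm q).const_mul a).add ((hsm' q).const_mul b), ?_, ?_⟩
  · rw [hval, iterate_tau_eq, map_add, map_smul, map_smul, hz,
      pow_apply_eq_zero_of_recursion hE' q (q + 1) (by omega), smul_zero, add_zero]
    rfl
  · rw [hval, iterate_tau_eq, add_tsub_cancel_right, map_add, map_smul, map_smul, hq,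
      pow_apply_of_recursion hE' q, smul_smul]
    -- `τ^q` scales the two coefficients by `(-n)^q q!` and `n^q q!`, which are nonzero, so
    -- independence at `q = 0` applies.
    refine h0 (a * (((-n : ℝ) : ℂ) ^ q * (q.factorial : ℂ)))
      (b * ((n : ℂ) ^ q * (q.factorial : ℂ))) ?_ ?_
    · have : (((-n : ℝ) : ℂ) ^ q * (q.factorial : ℂ)) ≠ 0 :=
        mul_ne_zero (pow_ne_zero _ (by simpa using hn)) hfac
      rw [ne_eq, mul_eq_zero, not_or]
      exact and_iff_left this
    · have : ((n : ℂ) ^ q * (q.factorial : ℂ)) ≠ 0 := mul_ne_zero (pow_ne_zero _ hnC) hfac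
      rw [ne_eq, mul_eq_zero, not_or]
      exact and_iff_left this

lemma treeSum_eq (hroot : ∀ α, node 0 α = h) (r : ℕ) (b c : ℝ) (q : ℕ) (x : S) :
    treeSum u node r b c q x = h x * ((Real.exp (b * u x) * u x ^ q : ℝ) : ℂ) +
      ∑ i ∈ Finset.Icc 1 r, ∑ α : Fin i → Eig A, node i α x * (nodeFun b c α q (u x) : ℂ) := by
  have hr : Finset.range (r + 1) = insert 0 (Finset.Icc 1 r) := by
    ext i
    simp only [Finset.mem_range, Finset.mem_insert, Finset.mem_Icc]
    omega
  rw [treeSum, hr, Finset.sum_insert (by simp)]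
  congr 1
  simp [hroot, nodeFun_fin_zero]

lemma phi_eq_treeSum {t : S → ℝ} (ht : ∀ x, 0 < t x) (hroot : ∀ α, node 0 α = h) (r q : ℕ) :
    phi t h node r (q + 1) = treeSum (fun x => Real.log (t x)) node r 0 (-nn A) q := by
  funext x
  rw [treeSum_eq hroot, phi]
  simp only [fFun_eq _ _ (ht x), zero_mul, Real.exp_zero, one_mul, add_tsub_cancel_right]

lemma psi_eq_treeSum {t : S → ℝ} (ht : ∀ x, 0 < t x) (hroot : ∀ α, node 0 α = h) (r q : ℕ) :
    psi t h node r (q + 1) = treeSum (fun x => Real.log (t x)) node r (nn A) (nn A) q := by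
  funext x
  rw [treeSum_eq hroot, psi]
  simp only [gFun_eq _ _ (ht x), add_tsub_cancel_right, Real.rpow_def_of_pos (ht x),
    mul_comm (nn A)]

/-- The exponent `1/n` of the modular function normalises the derivative along `A`, since `tr ad A =
n`. -/
lemma exists_isTCoordinate [SimplyConnectedSpace S] (hS : IsIwasawaType g)
    (hn : nil d S ≠ ⊥) (hA : IsUnitPositive g A) : ∃ t : S → ℝ, IsTCoordinate A t := by
  have hsymm := hS.symm A hA.mem
  have hpos := nn_pos hA.pos hn hsymm
  obtain ⟨t, h1, h2, h3, h4⟩ := exists_hom_mfderiv_eq_trace (d := d) (S := S) (nn A)⁻¹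
  refine ⟨t, h1, h2, h3, ?_, fun X hX => ?_⟩
  · have h5 : LinearMap.trace ℝ (LieAlg d S) (LieAlgebra.ad ℝ (LieAlg d S) A) = nn A :=
      trAd_eq_nn hsymm
    exact (h4 A).trans (by rw [h5, inv_mul_cancel₀ hpos.ne']; rfl)
  · have h5 : LinearMap.trace ℝ (LieAlg d S) (LieAlgebra.ad ℝ (LieAlg d S) X) = 0 :=
      trAd_eq_zero_of_mem_nil hX
    exact (h4 X).trans (by rw [h5, mul_zero]; rfl)

end Harmonic

end IwasawaRankOne

end

/-! ### The main theorem -/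

open IwasawaRankOne in
theorem mainTheorem1 {d : ℕ} {S : Type*} [TopologicalSpace S]
    [ChartedSpace (EuclideanSpace ℝ (Fin d)) S] [Group S] [LieGroup (𝓡 d) ∞ S]
    [SimplyConnectedSpace S] (g : Metric d S) (hS : IsIwasawaType g) (hrank : rank g = 1)
    (hn : nil d S ≠ ⊥) (A : LieAlg d S) (hA : IsUnitPositive g A) :
    (∃ t : S → ℝ, IsTCoordinate A t) ∧
    ∀ t : S → ℝ, IsTCoordinate A t →
      ∀ h : S → ℂ, ContMDiff (𝓡 d) 𝓘(ℝ, ℂ) ∞ h → IndepOfT A h → h ≠ 0 →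
      ∀ node : (i : ℕ) → (Fin i → Eig A) → S → ℂ, IsTensionTree g A t h node →
      ∀ r : ℕ, HasDegree node r →
      ∀ p : ℕ, 1 ≤ p →
        IsProperPHarmonic g p (psi t h node r p) ∧
        (NonDegenerate node →
          IsProperPHarmonic g p (phi t h node r p) ∧
          ∀ a b : ℂ, (a, b) ≠ (0, 0) →
            IsProperPHarmonic g p
              (fun x => a * phi t h node r p x + b * psi t h node r p x)) := by
  refine ⟨exists_isTCoordinate hS hn hA, ?_⟩
  intro t ht h _ _ hh node hnode r hr p hp
  obtain ⟨q, rfl⟩ : ∃ q, p = q + 1 := ⟨p - 1, by omega⟩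
  have hsymm := hS.symm A hA.mem
  have hpos := nn_pos hA.pos hn hsymm
  have htr : trAd A = nn A := trAd_eq_nn hsymm
  have hu := ht.isLogCoordinate hrank hA
  have hlam := lam_pos hA.pos
  have hten : ∀ i α x, tau g (node i α) x = ∑ k : Eig A,
      node (i + 1) (Fin.snoc α k : Fin (i + 1) → Eig A) x *
        (Real.exp (2 * lam k * Real.log (t x)) : ℂ) := by
    intro i α x
    rw [hnode.tension]
    refine Finset.sum_congr rfl fun k _ => ?_
    rw [Real.rpow_def_of_pos (ht.pos x), mul_comm (Real.log (t x))]
  have hroot : ∀ α, node 0 α ≠ 0 := fun α => by rwa [hnode.root α]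
  -- All three claims are instances: `(0, 1)` for `ψ_p`, `(1, 0)` for `φ_p`, and the general pair.
  have comb : ∀ a b : ℂ, (a ≠ 0 ∨ b ≠ 0) → (a ≠ 0 → NonDegenerate node) →
      IsProperPHarmonic g (q + 1)
        (fun x => a * phi t h node r (q + 1) x + b * psi t h node r (q + 1) x) := by
    intro a b hab hnd
    rw [phi_eq_treeSum ht.pos hnode.root, psi_eq_treeSum ht.pos hnode.root]
    refine isProperPHarmonic_comb hpos.ne' a b
      (isSmooth_treeSum hu hnode.smooth r _ _) (isSmooth_treeSum hu hnode.smooth r _ _)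
      (fun q ha x => ?_) (fun q x => ?_) (fun a' b' ha' hb' => ?_) q
    · refine tau_treeSum hu hrank hA hnode.smooth hnode.indep hten hr.1 (by ring)
        (by rw [htr]; ring) (fun i α hα => ?_) q x
      -- The last factor of the product is `2Λ + c` for `c = -n`, the divisor in the recurrence at
      -- this node.
      have h1 := Finset.prod_ne_zero_iff.1 (hnd ha (i + 1) α hα) (Fin.last i) (Finset.mem_univ _)
      rwa [Lam_last, sub_eq_add_neg] at h1
    · refine tau_treeSum hu hrank hA hnode.smooth hnode.indep hten hr.1 (by rw [htr]; ring)
        (by rw [htr]; ring) (fun i α _ => ?_) q x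
      have h1 := LamTop_pos hlam α
      positivity
    · refine treeSum_zero_comb_ne_zero hu hA hnode.smooth hnode.indep hroot r hpos ?_
      rwa [ha', hb']
  refine ⟨by simpa using comb 0 1 (by simp) (by simp), fun hnd => ⟨?_, fun a b hab => ?_⟩⟩
  · simpa using comb 1 0 (by simp) fun _ => hnd
  · refine comb a b ?_ fun _ => hnd
    by_contra hcon
    push Not at hcon
    exact hab (Prod.ext hcon.1 hcon.2)
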